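/- Let $T\ge 0$ and let $x_{t+1}=A_tx_t+w_t$ ($0\le t<T$) be an $\mathbb R^{n_t}$-valued Gauss--Markov process, where $x_0\sim\mathcal N(0,P_0)$ and $w_t\sim\mathcal N(0,W_t)$ are mutually independent and $P_0\succ0$, $W_t\succ0$. Let $\Theta_t\succeq0$ be $n_t\times n_t$ matrices and $D_t\ge0$ ($1\le t\le T$), and write $\|v\|_{\Theta}=\sqrt{v^\top\Theta v}$, $x^t=(x_0,\dots,x_t)$, $z^t=(z_1,\dots,z_t)$ with $z_t\in\mathbb R^{n_t}$. Let $\Gamma$ be the set of zero-delay policies, i.e. sequences $\gamma=(q(dz_t\mid x^t,z^{t-1}))_{t=1}^T$ of Borel stochastic kernels. Together with the source, $\gamma$ determines the joint law of $(x^T,z^T)$ by $q(dx^t,dz^t)=q(dz_t\mid x^t,z^{t-1})\,q(dx_t\mid x_{t-1})\,q(dx^{t-1},dz^{t-1})$. Let $\Gamma_1\subset\Gamma$ be the set of linear-Gaussian policies $$z_t=E_tx_t+F_{t,t-1}z_{t-1}+\dots+F_{t,1}z_1+g_t,$$ with arbitrary matrices $E_t,F_{t,s}$ and zero-mean, possibly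 degenerate Gaussian $g_t$, where $g_t$ is independent of $x_0,w_0,\dots,w_{T-1}$ and $g_1,\dots,g_{t-1}$; that is, given $(x^t,z^{t-1})$ the law of $z_t$ is $\mathcal N(E_tx_t+\sum_{s<t}F_{t,s}z_s,\,G_t)$ with $G_t\succeq 0$. Consider, under the constraints $\mathbb E\|x_t-z_t\|_{\Theta_t}^2\le D_t$ for $t=1,\dots,T$, the problems $$\text{(P-SRD)}\ \min_{\gamma\in\Gamma} I(x^T\to z^T):=\sum_{t=1}^TI(x^t;z_t\mid z^{t-1}),\qquad \text{(P-1)}\ \min_{\gamma\in\Gamma_1}\sum_{t=1}^TI(x_t;z_t\mid z^{t-1}).$$ (i) For every $\gamma\in\Gamma$ whose value $f_{\rm SRD}$ of the objective of (P-SRD) is finite there is $\gamma_1\in\Gamma_1$ whose value $f_1$ of the objective of (P-1) satisfies $f_1\le f_{\rm SRD}$, and such that for every $t$ with $\mathbb E_\gamma\|x_t-z_t\|_{\Theta_t}^2<\infty$ the distortions agree, $\mathbb E_{\gamma_1}\|x_t-z_t\|_{\Theta_t}^2=\mathbb E_{\gamma}\|x_t-z_t\|_{\Theta_t}^2$. In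 particular, if $\gamma$ is feasible for (P-SRD), then $\gamma_1$ is feasible for (P-1). (ii) For every $\gamma_1\in\Gamma_1$ the objectives of (P-SRD) and (P-1) take the same value, $\sum_{t=1}^T I(x^t;z_t\mid z^{t-1})=\sum_{t=1}^T I(x_t;z_t\mid z^{t-1})$ (in $[0,\infty]$). -/

import Mathlib

open MeasureTheory ProbabilityTheory InformationTheory Matrix
open scoped ENNReal NNReal

/-- The Euclidean space `ℝ^d`. -/
abbrev Vec (d : ℕ) : Type := EuclideanSpace ℝ (Fin d)

/-- Source paths `x^t = (x_0, …, x_t)` with `x_s ∈ ℝ^{n_s}`. -/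
abbrev SrcPath (n : ℕ → ℕ) (t : ℕ) : Type := ∀ s : Fin (t + 1), Vec (n s)

/-- Reproduction paths `z^t = (z_1, …, z_t)` with `z_s ∈ ℝ^{n_s}`; the entry with index `s : Fin t`
is `z_{s+1}`. -/
abbrev RepPath (n : ℕ → ℕ) (t : ℕ) : Type := ∀ s : Fin t, Vec (n (s + 1))

/-- `x^{t+1}` from `x^t` and `x_{t+1}`. -/
def srcSnoc {n : ℕ → ℕ} {t : ℕ} (x : SrcPath n t) (v : Vec (n (t + 1))) : SrcPath n (t + 1) :=
  Fin.snoc (α := fun s : Fin (t + 2) => Vec (n s)) x v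

/-- `z^{t+1}` from `z^t` and `z_{t+1}`. -/
def repSnoc {n : ℕ → ℕ} {t : ℕ} (z : RepPath n t) (v : Vec (n (t + 1))) : RepPath n (t + 1) :=
  Fin.snoc (α := fun s : Fin (t + 1) => Vec (n (s + 1))) z v

/-- The path `x^0 = (x_0)`. -/
def srcInit {n : ℕ → ℕ} (v : Vec (n 0)) : SrcPath n 0 :=
  Fin.snoc (α := fun s : Fin 1 => Vec (n s)) (fun s => s.elim0) v

theorem measurable_finSnoc {t : ℕ} {X : Fin (t + 1) → Type*} [∀ s, MeasurableSpace (X s)] :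
    Measurable (fun p : (∀ s : Fin t, X s.castSucc) × X (Fin.last t) =>
      (Fin.snoc (α := X) p.1 p.2 : ∀ s, X s)) := by
  refine measurable_pi_lambda _ fun s => ?_
  refine Fin.lastCases ?_ (fun i => ?_) s
  · simpa using measurable_snd
  · simp only [Fin.snoc_castSucc]
    exact (measurable_pi_apply i).comp measurable_fst

theorem measurable_srcSnoc {n : ℕ → ℕ} {t : ℕ} :
    Measurable (fun p : SrcPath n t × Vec (n (t + 1)) => srcSnoc p.1 p.2) :=
  measurable_finSnoc (X := fun s : Fin (t + 2) => Vec (n s))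

theorem measurable_repSnoc {n : ℕ → ℕ} {t : ℕ} :
    Measurable (fun p : RepPath n t × Vec (n (t + 1)) => repSnoc p.1 p.2) :=
  measurable_finSnoc (X := fun s : Fin (t + 1) => Vec (n (s + 1)))

theorem measurable_srcInit {n : ℕ → ℕ} : Measurable (srcInit (n := n)) :=
  (measurable_finSnoc (X := fun s : Fin 1 => Vec (n s))).comp
    (measurable_const.prodMk measurable_id)

open scoped MatrixOrder in
/-- The stochastic kernel `a ↦ N(f a, S)`. -/
noncomputable def gaussianKernel {α : Type*} [MeasurableSpace α] {d : ℕ} (f : α → Vec d)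
    (hf : Measurable f) (S : Matrix (Fin d) (Fin d) ℝ) : Kernel α (Vec d) where
  toFun a := multivariateGaussian (f a) S
  measurable' := by
    refine Measure.measurable_of_measurable_coe _ fun s hs => ?_
    have hm : Measurable (fun p : α × Vec d =>
        f p.1 + toEuclideanCLM (𝕜 := ℝ) (CFC.sqrt S) p.2) := by fun_prop
    have h := measurable_measure_prodMk_left (ν := stdGaussian (Vec d)) (hm hs)
    convert h using 1
    funext a
    rw [multivariateGaussian, Measure.map_apply (by fun_prop) hs]
    rfl

instance {α : Type*} [MeasurableSpace α] {d : ℕ} (f : α → Vec d)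
    (hf : Measurable f) (S : Matrix (Fin d) (Fin d) ℝ) : IsMarkovKernel (gaussianKernel f hf S) :=
  ⟨fun a => by change IsProbabilityMeasure (multivariateGaussian (f a) S); infer_instance⟩

/-- The data of a Gauss-Markov source with horizon `T`: `x_0 ∼ N(0, P₀)` and
`x_{t+1} = A_t x_t + w_t` with `w_t ∼ N(0, W_t)` for `t = 0, …, T - 1`, where `x_t ∈ ℝ^{n_t}` and
`x_0, w_0, …, w_{T-1}` are independent. Only the entries with `t ≤ T` (for `n`) and `t < T`
(for `A` and `W`) matter. -/
structure GaussMarkovSource (T : ℕ) where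
  n : ℕ → ℕ
  A : ∀ t : ℕ, Matrix (Fin (n (t + 1))) (Fin (n t)) ℝ
  P₀ : Matrix (Fin (n 0)) (Fin (n 0)) ℝ
  W : ∀ t : ℕ, Matrix (Fin (n (t + 1))) (Fin (n (t + 1))) ℝ
  P₀_posDef : P₀.PosDef
  W_posDef : ∀ t < T, (W t).PosDef

/-- Zero-delay reproduction policies: sequences of causal stochastic kernels;
`kernel t` is `q(dz_{t+1} | x^{t+1}, z^t)`. For a problem with horizon `T` only the kernels with
`t < T` matter. -/
structure ZeroDelayPolicy (n : ℕ → ℕ) where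
  kernel : ∀ t : ℕ, Kernel (SrcPath n (t + 1) × RepPath n t) (Vec (n (t + 1)))
  markov : ∀ t, IsMarkovKernel (kernel t)

attribute [instance] ZeroDelayPolicy.markov

/-- The linear-Gaussian policies
`z_t = E_t x_t + F_{t,t-1} z_{t-1} + ⋯ + F_{t,1} z_1 + g_t`, with `g_t ∼ N(0, G_t)` (possibly
degenerate) independent of the past: given `(x^t, z^{t-1})`, the law of `z_t` is
`N(E_t x_t + ∑ s, F_{t,s} z_s, G_t)`. -/
def ZeroDelayPolicy.IsLinearGaussian {n : ℕ → ℕ} (γ : ZeroDelayPolicy n) : Prop :=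
  ∃ (E : ∀ t : ℕ, Matrix (Fin (n (t + 1))) (Fin (n (t + 1))) ℝ)
    (F : ∀ (t : ℕ) (s : Fin t), Matrix (Fin (n (t + 1))) (Fin (n (s + 1))) ℝ)
    (G : ∀ t : ℕ, Matrix (Fin (n (t + 1))) (Fin (n (t + 1))) ℝ),
    (∀ t, (G t).PosSemidef) ∧
    ∀ (t : ℕ) (x : SrcPath n (t + 1)) (z : RepPath n t),
      γ.kernel t (x, z) =
        multivariateGaussian
          (toEuclideanLin (E t) (x (Fin.last (t + 1))) + ∑ s : Fin t, toEuclideanLin (F t s) (z s)) (G t)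

namespace GaussMarkovSource

variable {T : ℕ} (S : GaussMarkovSource T)

/-- The transition kernel of the source, `q(dx_{t+1} | x^t, z^t) = N(A_t x_t, W_t)`. -/
noncomputable def srcKernel (t : ℕ) :
    Kernel (SrcPath S.n t × RepPath S.n t) (Vec (S.n (t + 1))) :=
  gaussianKernel (fun p => toEuclideanLin (S.A t) (p.1 (Fin.last t)))
    ((toEuclideanLin (S.A t)).continuous_of_finiteDimensional.measurable.comp
      ((measurable_pi_apply (Fin.last t)).comp measurable_fst))
    (S.W t)

instance (t : ℕ) : IsMarkovKernel (S.srcKernel t) := by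
  unfold srcKernel
  infer_instance

/-- The joint law of `(x^t, z^t)` generated by the source and the policy `γ`: first
`q(dx^{t+1}, dz^t) = q(dx_{t+1} | x_t) q(dx^t, dz^t)`, then
`q(dx^{t+1}, dz^{t+1}) = q(dz_{t+1} | x^{t+1}, z^t) q(dx^{t+1}, dz^t)`. -/
noncomputable def jointLaw (γ : ZeroDelayPolicy S.n) :
    ∀ t : ℕ, Measure (SrcPath S.n t × RepPath S.n t)
  | 0 => (multivariateGaussian 0 S.P₀).map (fun v => (srcInit v, fun s => s.elim0))
  | t + 1 =>
    ((jointLaw γ t ⊗ₘ S.srcKernel t) ⊗ₘ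
      (γ.kernel t).comap (fun ω => (srcSnoc ω.1.1 ω.2, ω.1.2))
        ((measurable_srcSnoc.comp
          ((measurable_fst.comp measurable_fst).prodMk measurable_snd)).prodMk
            (measurable_snd.comp measurable_fst))).map
      (fun ω => (srcSnoc ω.1.1.1 ω.1.2, repSnoc ω.1.1.2 ω.2))

instance isProbabilityMeasure_jointLaw (γ : ZeroDelayPolicy S.n) (t : ℕ) :
    IsProbabilityMeasure (S.jointLaw γ t) := by
  induction t with
  | zero =>
    exact Measure.isProbabilityMeasure_map
      (measurable_srcInit.prodMk measurable_const).aemeasurable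
  | succ t ih =>
    refine Measure.isProbabilityMeasure_map (Measurable.aemeasurable ?_)
    exact (measurable_srcSnoc.comp
      ((measurable_fst.comp (measurable_fst.comp measurable_fst)).prodMk
        (measurable_snd.comp measurable_fst))).prodMk
      (measurable_repSnoc.comp
        ((measurable_snd.comp (measurable_fst.comp measurable_fst)).prodMk measurable_snd))

end GaussMarkovSource

section Coordinates

variable {n : ℕ → ℕ} {T : ℕ}

/-- The random vector `x_{t+1}` on the space of paths `(x^T, z^T)`. -/
def srcAt (t : Fin T) (ω : SrcPath n T × RepPath n T) : Vec (n (t + 1)) := ω.1 t.succ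

/-- The random path `x^{t+1} = (x_0, …, x_{t+1})`. -/
def srcUpTo (t : Fin T) (ω : SrcPath n T × RepPath n T) : SrcPath n (t + 1) :=
  fun s => ω.1 (s.castLE (Nat.succ_le_succ t.isLt))

/-- The random vector `z_{t+1}`. -/
def repAt (t : Fin T) (ω : SrcPath n T × RepPath n T) : Vec (n (t + 1)) := ω.2 t

/-- The random path `z^t = (z_1, …, z_t)`. -/
def repBefore (t : Fin T) (ω : SrcPath n T × RepPath n T) : RepPath n t :=
  fun s => ω.2 (s.castLE t.isLt.le)

end Coordinates

/-- The conditional mutual information `I(X; Y | Z)`: the divergence of the conditional law of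
`(X, Y)` given `Z = z` from the product of the conditional laws of `X` and of `Y`, averaged over the
law of `Z`. -/
noncomputable def condMutualInfo {Ω α β δ : Type*} [MeasurableSpace Ω]
    [MeasurableSpace α] [StandardBorelSpace α] [Nonempty α]
    [MeasurableSpace β] [StandardBorelSpace β] [Nonempty β] [MeasurableSpace δ]
    (μ : Measure Ω) [IsFiniteMeasure μ] (X : Ω → α) (Y : Ω → β) (Z : Ω → δ) : ℝ≥0∞ :=
  ∫⁻ z, klDiv (condDistrib (fun ω => (X ω, Y ω)) Z μ z)
    ((condDistrib X Z μ z).prod (condDistrib Y Z μ z)) ∂(μ.map Z)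

/-- The weighted seminorm `‖v‖_Θ = √(vᵀ Θ v)`. -/
noncomputable def weightedNorm {d : ℕ} (Θ : Matrix (Fin d) (Fin d) ℝ) (v : Vec d) : ℝ :=
  √(v.ofLp ⬝ᵥ Θ *ᵥ v.ofLp)

namespace GaussMarkovSource

variable {T : ℕ} (S : GaussMarkovSource T)

/-- The objective of (P-SRD), the directed information
`I(x^T → z^T) = ∑_{t=1}^T I(x^t; z_t | z^{t-1})`. -/
noncomputable def directedInfo (γ : ZeroDelayPolicy S.n) : ℝ≥0∞ :=
  ∑ t : Fin T, condMutualInfo (S.jointLaw γ T) (srcUpTo t) (repAt t) (repBefore t)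

/-- The objective of (P-1), `∑_{t=1}^T I(x_t; z_t | z^{t-1})`. -/
noncomputable def stepwiseInfo (γ : ZeroDelayPolicy S.n) : ℝ≥0∞ :=
  ∑ t : Fin T, condMutualInfo (S.jointLaw γ T) (srcAt t) (repAt t) (repBefore t)

/-- The distortion `E ‖x_{t+1} - z_{t+1}‖_Θ²`, in `[0, ∞]`. -/
noncomputable def distortion (γ : ZeroDelayPolicy S.n) (t : Fin T)
    (Θ : Matrix (Fin (S.n (t + 1))) (Fin (S.n (t + 1))) ℝ) : ℝ≥0∞ :=
  ∫⁻ ω, ENNReal.ofReal (weightedNorm Θ (srcAt t ω - repAt t ω) ^ 2) ∂(S.jointLaw γ T)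

/-- The distortion constraints `E ‖x_t - z_t‖_{Θ_t}² ≤ D_t`, `t = 1, …, T`, of (P-SRD) and (P-1);
`Θ` and `D` are indexed by `t - 1`. -/
def IsFeasible (Θ : ∀ t : Fin T, Matrix (Fin (S.n (t + 1))) (Fin (S.n (t + 1))) ℝ)
    (D : Fin T → ℝ≥0) (γ : ZeroDelayPolicy S.n) : Prop :=
  ∀ t : Fin T, S.distortion γ t (Θ t) ≤ D t

end GaussMarkovSource

/-! Fix `γ` with finite directed information and compare its joint law with that of a blind policy,
which draws z_t from the same conditional law given z^{t-1} but ignores the source. By the chain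
rule and data processing the divergence between the two laws is at most I(x^T → z^T)
(`klDiv_jointLaw_blindPolicy_le`). Donsker-Varadhan (`ofReal_integral_le_klDiv`) then gives E_γ f ≤
I(x^T → z^T) for every integrable f whose exponential has blind mean at most 1.

The right f comes from Kalman filtering. Let K_t z^t be the linear regression of x_t on z^t under
`γ`, with residual second moments C_t. Take for f the sum over t of the log density ratios, at
x_{t+1}, of N(K_{t+1} z^{t+1}, C_{t+1}) to the prediction N(A_t K_t z^t, A_t C_t A_tᵀ + W_t). Under
the blind law, weighting by the exponential of the partial sum turns the conditional law of x_t
given z^t into N(K_t z^t, C_t), so the total mass stays 1 (`lintegral_exp_logLik`). Under `γ` the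
mean of f involves second moments only; it is the sum of the numbers `infoRate`.

Conversely, let the linear-Gaussian policy generate z_{t+1} from its linear regression on (z^t,
x_{t+1}), plus Gaussian noise with the residual second moments. By induction (z^t, x_t) becomes the
centred Gaussian vector with the second moments it has under `γ` (`isCopyAt`). Distortions are
quadratic, so they agree; the summands of f are now true log likelihood ratios, so the step-t
information equals `infoRate` (`condMutualInfo_policy`).

Two obstacles remain. The densities require C_{t+1} ≻ 0: otherwise a linear form of x_{t+1} would be
almost surely a function of z^{t+1}, a null event for the blind law because W_t ≻ 0, whereas finite
information makes the joint law absolutely continuous with respect to the blind one (`C_posDef`).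
Moreover z_t need not be square integrable, since a finite distortion controls it only modulo the
kernel of Θ_t. So z_t is replaced by L z_t, with L a projection along that kernel, or L = 0 where
the distortion is infinite.

Part (ii) holds because a linear-Gaussian z_t depends on (x^t, z^{t-1}) only through (x_t, z^{t-1}).
-/

/-! ### Kullback-Leibler divergence: kernels, Donsker-Varadhan, exponential densities -/

section Divergence

variable {α β : Type*} {mα : MeasurableSpace α} {mβ : MeasurableSpace β}

theorem klDiv_withDensity_eq_lintegral {ν : Measure α} [IsFiniteMeasure ν] {f : α → ℝ≥0∞}
    (hf : Measurable f) [IsFiniteMeasure (ν.withDensity f)] :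
    klDiv (ν.withDensity f) ν = ∫⁻ x, ENNReal.ofReal (klFun (f x).toReal) ∂ν := by
  rw [klDiv_eq_lintegral_klFun_of_ac (withDensity_absolutelyContinuous ν f)]
  refine lintegral_congr_ae ?_
  filter_upwards [Measure.rnDeriv_withDensity ν hf] with x hx
  rw [hx]

section Kernels

variable [MeasurableSpace.CountableOrCountablyGenerated α β] (κ η : Kernel α β)
  [IsMarkovKernel κ] [IsMarkovKernel η]

theorem klDiv_kernel_of_ac {a : α} (h : κ a ≪ η a) :
    klDiv (κ a) (η a) = ∫⁻ x, ENNReal.ofReal (klFun (κ.rnDeriv η a x).toReal) ∂(η a) := by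
  rw [klDiv_eq_lintegral_klFun_of_ac h]
  refine lintegral_congr_ae ?_
  filter_upwards [Kernel.rnDeriv_eq_rnDeriv_measure (κ := κ) (η := η) (a := a)] with x hx
  rw [hx]

omit [IsMarkovKernel κ] [IsMarkovKernel η] in
theorem measurable_ofReal_klFun_rnDeriv :
    Measurable (fun p : α × β => ENNReal.ofReal (klFun (κ.rnDeriv η p.1 p.2).toReal)) :=
  (measurable_klFun.comp (Kernel.measurable_rnDeriv κ η).ennreal_toReal).ennreal_ofReal

/-- The kernel Radon-Nikodym derivative is jointly measurable and absolute continuity is a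
measurable condition on the parameter, so the divergence is an integral of a measurable function on
one measurable set and ⊤ on its complement. -/
theorem measurable_klDiv_kernel : Measurable (fun a => klDiv (κ a) (η a)) := by
  classical
  have h : (fun a => klDiv (κ a) (η a)) = fun a => if κ a ≪ η a then
      ∫⁻ x, ENNReal.ofReal (klFun (κ.rnDeriv η a x).toReal) ∂(η a) else ⊤ := by
    funext a
    split_ifs with ha
    · exact klDiv_kernel_of_ac κ η ha
    · exact klDiv_of_not_ac ha
  rw [h]
  exact Measurable.ite (Kernel.measurableSet_absolutelyContinuous κ η)
    (measurable_ofReal_klFun_rnDeriv κ η).lintegral_kernel_prod_right' measurable_const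

/-- The conditional divergence is the divergence of the composition-products. -/
theorem lintegral_klDiv_kernel (μ : Measure α) [IsFiniteMeasure μ] :
    ∫⁻ a, klDiv (κ a) (η a) ∂μ = klDiv (μ ⊗ₘ κ) (μ ⊗ₘ η) := by
  by_cases hac : ∀ᵐ a ∂μ, κ a ≪ η a
  · have hd : μ ⊗ₘ κ = (μ ⊗ₘ η).withDensity (fun p => κ.rnDeriv η p.1 p.2) := by
      ext s hs
      rw [withDensity_apply _ hs, ← lintegral_indicator hs,
        Measure.lintegral_compProd ((Kernel.measurable_rnDeriv κ η).indicator hs),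
        Measure.compProd_apply hs]
      refine lintegral_congr_ae ?_
      filter_upwards [hac] with a ha
      have h1 : κ a = (η a).withDensity (κ.rnDeriv η a) := by
        rw [← Measure.withDensity_rnDeriv_eq _ _ ha]
        exact withDensity_congr_ae
          (Kernel.rnDeriv_eq_rnDeriv_measure (κ := κ) (η := η) (a := a)).symm
      rw [h1, withDensity_apply _ (measurable_prodMk_left hs),
        ← lintegral_indicator (measurable_prodMk_left hs)]
      rfl
    have : IsFiniteMeasure ((μ ⊗ₘ η).withDensity (fun p => κ.rnDeriv η p.1 p.2)) :=
      hd ▸ inferInstance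
    rw [hd, klDiv_withDensity_eq_lintegral (Kernel.measurable_rnDeriv κ η),
      Measure.lintegral_compProd (measurable_ofReal_klFun_rnDeriv κ η)]
    refine lintegral_congr_ae ?_
    filter_upwards [hac] with a ha using klDiv_kernel_of_ac κ η ha
  · rw [klDiv_of_not_ac (fun h => hac (Measure.absolutelyContinuous_compProd_right_iff.1 h))]
    -- A finite mean divergence would make the divergence finite almost everywhere, and so force the
    -- absolute continuity that fails here.
    by_contra hne
    refine hac ?_
    filter_upwards [ae_lt_top (measurable_klDiv_kernel κ η) hne] with a ha
    exact (klDiv_ne_top_iff.1 ha.ne).1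

end Kernels

theorem klDiv_map_measurableEquiv (e : α ≃ᵐ β) (μ ν : Measure α) [IsFiniteMeasure μ]
    [IsFiniteMeasure ν] : klDiv (μ.map e) (ν.map e) = klDiv μ ν := by
  refine le_antisymm (klDiv_map_le _ _ e.measurable) ?_
  have h := klDiv_map_le (μ.map e) (ν.map e) e.symm.measurable
  simpa [Measure.map_map e.symm.measurable e.measurable] using h

/-- The Donsker-Varadhan lower bound. -/
theorem ofReal_integral_le_klDiv {μ ν : Measure α} [IsProbabilityMeasure μ]
    [IsProbabilityMeasure ν] {f : α → ℝ} (hfm : Measurable f) (hf : Integrable f μ)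
    (hν : ∫⁻ x, ENNReal.ofReal (Real.exp (f x)) ∂ν ≤ 1) :
    ENNReal.ofReal (∫ x, f x ∂μ) ≤ klDiv μ ν := by
  by_cases htop : klDiv μ ν = ⊤
  · simp [htop]
  obtain ⟨hac, hint⟩ := klDiv_ne_top_iff.1 htop
  have hexp : Integrable (fun x => Real.exp (f x)) ν := by
    refine ⟨(Real.measurable_exp.comp hfm).aestronglyMeasurable, ?_⟩
    rw [hasFiniteIntegral_iff_ofReal (ae_of_all _ fun x => (Real.exp_pos _).le)]
    exact hν.trans_lt ENNReal.one_lt_top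
  have hle : ∫ x, Real.exp (f x) ∂ν ≤ 1 := by
    rw [integral_eq_lintegral_of_nonneg_ae (ae_of_all _ fun x => (Real.exp_pos _).le)
      hexp.aestronglyMeasurable]
    exact ENNReal.toReal_le_of_le_ofReal zero_le_one (by simpa using hν)
  have hpos : 0 < ∫ x, Real.exp (f x) ∂ν := integral_exp_pos hexp
  -- With respect to `ν` tilted by `f`, the mean log likelihood ratio of `μ` is KL(μ, ν) - ∫ f dμ +
  -- log ∫ exp f dν. It is nonnegative, and the last term is at most 0.
  have h1 := integral_llr_tilted_right hac hf hexp hint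
  have : IsProbabilityMeasure (ν.tilted f) := isProbabilityMeasure_tilted hexp
  have h2 := integral_llr_add_sub_measure_univ_nonneg
    (hac.trans (absolutelyContinuous_tilted hexp)) (integrable_llr_tilted_right hac hf hint hexp)
  have h3 : Real.log (∫ x, Real.exp (f x) ∂ν) ≤ 0 := Real.log_nonpos hpos.le hle
  rw [← ENNReal.ofReal_toReal htop, toReal_klDiv_of_measure_eq hac (by simp)]
  refine ENNReal.ofReal_le_ofReal ?_
  simp only [probReal_univ, add_sub_cancel_right] at h2
  linarith

theorem llr_withDensity_exp {μ ν : Measure α} [SigmaFinite ν] {f : α → ℝ} (hfm : Measurable f)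
    (hμ : μ = ν.withDensity (fun x => ENNReal.ofReal (Real.exp (f x)))) : llr μ ν =ᵐ[μ] f := by
  have hac : μ ≪ ν := hμ ▸ withDensity_absolutelyContinuous _ _
  refine hac.ae_le ?_
  have h := Measure.rnDeriv_withDensity ν
    (f := fun x => ENNReal.ofReal (Real.exp (f x)))
    (Real.measurable_exp.comp hfm).ennreal_ofReal
  rw [← hμ] at h
  filter_upwards [h] with x hx
  rw [llr, hx, ENNReal.toReal_ofReal (Real.exp_pos _).le, Real.log_exp]

section DensityExp

variable {μ ν : Measure α} [IsProbabilityMeasure μ] [IsProbabilityMeasure ν] {f : α → ℝ}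

/-- If `μ` has density `exp f` with respect to `ν`, then the divergence is the mean of `f`. -/
theorem klDiv_withDensity_exp (hfm : Measurable f) (hf : Integrable f μ)
    (hμ : μ = ν.withDensity (fun x => ENNReal.ofReal (Real.exp (f x)))) :
    klDiv μ ν = ENNReal.ofReal (∫ x, f x ∂μ) := by
  have hac : μ ≪ ν := hμ ▸ withDensity_absolutelyContinuous _ _
  have hllr := llr_withDensity_exp hfm hμ
  rw [klDiv_of_ac_of_integrable hac ((integrable_congr hllr).2 hf), integral_congr_ae hllr]
  simp

theorem integral_nonneg_of_withDensity_exp (hfm : Measurable f) (hf : Integrable f μ)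
    (hμ : μ = ν.withDensity (fun x => ENNReal.ofReal (Real.exp (f x)))) : 0 ≤ ∫ x, f x ∂μ := by
  have hac : μ ≪ ν := hμ ▸ withDensity_absolutelyContinuous _ _
  have hllr := llr_withDensity_exp hfm hμ
  have h := integral_llr_add_sub_measure_univ_nonneg hac ((integrable_congr hllr).2 hf)
  simpa [integral_congr_ae hllr] using h

end DensityExp

end Divergence

/-! ### Conditional mutual information as a divergence of joint laws -/

section CondMutualInfo

variable {Ω α β δ : Type*} [MeasurableSpace Ω]
    [MeasurableSpace α] [StandardBorelSpace α] [Nonempty α]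
    [MeasurableSpace β] [StandardBorelSpace β] [Nonempty β] [MeasurableSpace δ]
    {μ : Measure Ω} [IsFiniteMeasure μ] {X : Ω → α} {Y : Ω → β} {Z : Ω → δ}

theorem condMutualInfo_eq_klDiv (hX : Measurable X) (hY : Measurable Y) :
    condMutualInfo μ X Y Z = klDiv (μ.map (fun ω => (Z ω, (X ω, Y ω))))
      (μ.map Z ⊗ₘ (condDistrib X Z μ ×ₖ condDistrib Y Z μ)) := by
  rw [← compProd_map_condDistrib (hX.prodMk hY).aemeasurable, ← lintegral_klDiv_kernel]
  simp only [condMutualInfo, Kernel.prod_apply]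

omit [MeasurableSpace Ω] [StandardBorelSpace α] [Nonempty α] [StandardBorelSpace β]
  [Nonempty β] in
theorem compProd_prod_map_assoc_symm (ν : Measure δ) [IsFiniteMeasure ν] (κ : Kernel δ α)
    (η : Kernel δ β) [IsMarkovKernel κ] [IsMarkovKernel η] :
    (ν ⊗ₘ (κ ×ₖ η)).map MeasurableEquiv.prodAssoc.symm
      = (ν ⊗ₘ κ) ⊗ₘ η.comap Prod.fst measurable_fst := by
  ext s hs
  have hs' := MeasurableEquiv.prodAssoc.symm.measurable hs
  rw [Measure.map_apply MeasurableEquiv.prodAssoc.symm.measurable hs, Measure.compProd_apply hs',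
    Measure.compProd_apply hs, Measure.lintegral_compProd
      (Kernel.measurable_kernel_prodMk_left hs)]
  refine lintegral_congr fun z => ?_
  rw [Kernel.prod_apply, Measure.prod_apply (measurable_prodMk_left hs')]
  rfl

/-- Reassociating the triple absorbs the conditional law of `X` into the law of `(Z, X)`, so only a
version `κ` of the conditional law of `Y` given `Z` has to be known. This is the form in which
informations are computed below. -/
theorem condMutualInfo_eq_klDiv_of_right (hX : Measurable X) (hY : Measurable Y)
    {κ : Kernel δ β} [IsMarkovKernel κ]
    (hκ : μ.map (fun ω => (Z ω, Y ω)) = μ.map Z ⊗ₘ κ) :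
    condMutualInfo μ X Y Z = klDiv (μ.map (fun ω => ((Z ω, X ω), Y ω)))
      (μ.map (fun ω => (Z ω, X ω)) ⊗ₘ κ.comap Prod.fst measurable_fst) := by
  by_cases hZ : AEMeasurable Z μ
  swap
  · have h1 : ¬ AEMeasurable (fun ω => ((Z ω, X ω), Y ω)) μ := fun h => hZ h.fst.fst
    have h2 : ¬ AEMeasurable (fun ω => (Z ω, X ω)) μ := fun h => hZ h.fst
    rw [Measure.map_of_not_aemeasurable h1, Measure.map_of_not_aemeasurable h2]
    simp [condMutualInfo, Measure.map_of_not_aemeasurable hZ]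
  have hae := condDistrib_ae_eq_of_measure_eq_compProd Z hY.aemeasurable hκ
  have hpr : (condDistrib X Z μ ×ₖ condDistrib Y Z μ) =ᵐ[μ.map Z] (condDistrib X Z μ ×ₖ κ) := by
    filter_upwards [hae] with z hz
    rw [Kernel.prod_apply, Kernel.prod_apply, hz]
  rw [condMutualInfo_eq_klDiv hX hY, Measure.compProd_congr hpr,
    ← klDiv_map_measurableEquiv MeasurableEquiv.prodAssoc.symm, compProd_prod_map_assoc_symm,
    compProd_map_condDistrib hX.aemeasurable,
    AEMeasurable.map_map_of_aemeasurable MeasurableEquiv.prodAssoc.symm.measurable.aemeasurable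
      (hZ.prodMk (hX.prodMk hY).aemeasurable)]
  rfl

theorem condMutualInfo_comm (hX : Measurable X) (hY : Measurable Y) :
    condMutualInfo μ X Y Z = condMutualInfo μ Y X Z := by
  by_cases hZ : AEMeasurable Z μ
  swap
  · simp [condMutualInfo, Measure.map_of_not_aemeasurable hZ]
  let e : δ × α × β ≃ᵐ δ × β × α :=
    (MeasurableEquiv.refl δ).prodCongr MeasurableEquiv.prodComm
  rw [condMutualInfo_eq_klDiv hX hY, condMutualInfo_eq_klDiv hY hX,
    ← klDiv_map_measurableEquiv e, AEMeasurable.map_map_of_aemeasurable e.measurable.aemeasurable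
      (hZ.prodMk (hX.prodMk hY).aemeasurable)]
  congr 1
  ext s hs
  rw [Measure.map_apply e.measurable hs, Measure.compProd_apply (e.measurable hs),
    Measure.compProd_apply hs]
  refine lintegral_congr fun z => ?_
  rw [← Kernel.map_prod_swap (condDistrib Y Z μ) (condDistrib X Z μ),
    Kernel.map_apply' _ measurable_swap _ (measurable_prodMk_left (e.measurable hs))]
  rfl

omit [StandardBorelSpace α] [Nonempty α] [StandardBorelSpace β] [Nonempty β] in
theorem map_compProd_comap {α' : Type*} [MeasurableSpace α'] (m : Measure α) [IsFiniteMeasure m]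
    (κ : Kernel α' β) [IsMarkovKernel κ] {f : α → α'} (hf : Measurable f) :
    (m ⊗ₘ κ.comap f hf).map (Prod.map f id) = m.map f ⊗ₘ κ := by
  ext s hs
  rw [Measure.map_apply (hf.prodMap measurable_id) hs,
    Measure.compProd_apply (hf.prodMap measurable_id hs), Measure.compProd_apply hs,
    lintegral_map (Kernel.measurable_kernel_prodMk_left hs) hf]
  rfl

-- Both sides average the same divergence, which sees the base point only through `f`.
omit [StandardBorelSpace α] [Nonempty α] [StandardBorelSpace β] [Nonempty β] in
theorem klDiv_compProd_comap {α' : Type*} [MeasurableSpace α'] (m : Measure α) [IsFiniteMeasure m]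
    [MeasurableSpace.CountablyGenerated β]
    (κ η : Kernel α' β) [IsMarkovKernel κ] [IsMarkovKernel η] {f : α → α'} (hf : Measurable f) :
    klDiv (m ⊗ₘ κ.comap f hf) (m ⊗ₘ η.comap f hf) = klDiv (m.map f ⊗ₘ κ) (m.map f ⊗ₘ η) := by
  rw [← lintegral_klDiv_kernel, ← lintegral_klDiv_kernel,
    lintegral_map (measurable_klDiv_kernel κ η) hf]
  rfl

/-- If `Y` depends on `(Z, X)` only through `(Z, f X)`, then `I(X; Y | Z) = I(f X; Y | Z)`. -/
theorem condMutualInfo_comp_left_of_kernel {α' : Type*} [MeasurableSpace α']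
    [StandardBorelSpace α'] [Nonempty α'] (hX : Measurable X) (hY : Measurable Y)
    (hZ : Measurable Z) {f : α → α'} (hf : Measurable f)
    (π : Kernel (δ × α') β) [IsMarkovKernel π]
    (hπ : μ.map (fun ω => ((Z ω, X ω), Y ω)) = μ.map (fun ω => (Z ω, X ω)) ⊗ₘ
      π.comap (Prod.map id f) (measurable_id.prodMap hf)) :
    condMutualInfo μ X Y Z = condMutualInfo μ (fun ω => f (X ω)) Y Z := by
  have hκ : μ.map (fun ω => (Z ω, Y ω)) = μ.map Z ⊗ₘ condDistrib Y Z μ :=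
    (compProd_map_condDistrib hY.aemeasurable).symm
  rw [condMutualInfo_eq_klDiv_of_right hX hY hκ,
    condMutualInfo_eq_klDiv_of_right (X := fun ω => f (X ω)) (hf.comp hX) hY hκ, hπ]
  have h1 : μ.map (fun ω => ((Z ω, f (X ω)), Y ω)) =
      (μ.map (fun ω => (Z ω, X ω))).map (Prod.map id f) ⊗ₘ π := by
    rw [← map_compProd_comap _ _ (measurable_id.prodMap hf), ← hπ,
      Measure.map_map (by fun_prop) (by fun_prop)]
    rfl
  have h2 : μ.map (fun ω => (Z ω, f (X ω))) =
      (μ.map (fun ω => (Z ω, X ω))).map (Prod.map id f) := by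
    rw [Measure.map_map (by fun_prop) (by fun_prop)]
    rfl
  have h := klDiv_compProd_comap (μ.map (fun ω => (Z ω, X ω))) π
    ((condDistrib Y Z μ).comap Prod.fst measurable_fst)
    (f := Prod.map id f) (measurable_id.prodMap hf)
  change _ = klDiv (μ.map (fun ω => ((Z ω, f (X ω)), Y ω))) (μ.map (fun ω => (Z ω, f (X ω))) ⊗ₘ _)
  rw [h1, h2, ← h]
  rfl

end CondMutualInfo

/-! ### Truncation of paths and marginals of the joint law -/

section Truncation

variable {n : ℕ → ℕ} {t T : ℕ}

/-- The truncation of a pair of paths `(x^T, z^T)` to `(x^t, z^t)`. -/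
def truncPath (h : t ≤ T) (ω : SrcPath n T × RepPath n T) : SrcPath n t × RepPath n t :=
  (fun s => ω.1 (s.castLE (Nat.succ_le_succ h)), fun s => ω.2 (s.castLE h))

@[fun_prop]
theorem measurable_truncPath (h : t ≤ T) : Measurable (truncPath (n := n) h) := by
  unfold truncPath
  fun_prop

/-- The path `z^t` inside `z^{t+1}`. -/
def repInit (z : RepPath n (t + 1)) : RepPath n t := fun s => z s.castSucc

@[fun_prop]
theorem measurable_repInit : Measurable (repInit : RepPath n (t + 1) → RepPath n t) := by
  unfold repInit
  fun_prop

@[simp]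
theorem repInit_repSnoc (z : RepPath n t) (v : Vec (n (t + 1))) : repInit (repSnoc z v) = z := by
  funext s
  exact Fin.snoc_castSucc (α := fun s : Fin (t + 1) => Vec (n (s + 1))) v z s

@[simp]
theorem repSnoc_last (z : RepPath n t) (v : Vec (n (t + 1))) : repSnoc z v (Fin.last t) = v :=
  Fin.snoc_last (α := fun s : Fin (t + 1) => Vec (n (s + 1))) v z

@[simp]
theorem srcSnoc_last (x : SrcPath n t) (v : Vec (n (t + 1))) :
    srcSnoc x v (Fin.last (t + 1)) = v :=
  Fin.snoc_last (α := fun s : Fin (t + 2) => Vec (n s)) v x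

theorem srcSnoc_castSucc (x : SrcPath n t) (v : Vec (n (t + 1))) (s : Fin (t + 1)) :
    srcSnoc x v s.castSucc = x s :=
  Fin.snoc_castSucc (α := fun s : Fin (t + 2) => Vec (n s)) v x s

theorem repSnoc_repInit (z : RepPath n (t + 1)) : repSnoc (repInit z) (z (Fin.last t)) = z :=
  Fin.snoc_init_self (α := fun s : Fin (t + 1) => Vec (n (s + 1))) z

end Truncation

namespace GaussMarkovSource

variable {T : ℕ} (S : GaussMarkovSource T) (γ : ZeroDelayPolicy S.n)

theorem measurable_srcStep (t : ℕ) :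
    Measurable (fun ω : (SrcPath S.n t × RepPath S.n t) × Vec (S.n (t + 1)) =>
      (srcSnoc ω.1.1 ω.2, ω.1.2)) :=
  (measurable_srcSnoc.comp ((measurable_fst.comp measurable_fst).prodMk measurable_snd)).prodMk
    (measurable_snd.comp measurable_fst)

theorem measurable_repStep (t : ℕ) :
    Measurable (fun ω : (SrcPath S.n (t + 1) × RepPath S.n t) × Vec (S.n (t + 1)) =>
      (ω.1.1, repSnoc ω.1.2 ω.2)) :=
  (measurable_fst.comp measurable_fst).prodMk (measurable_repSnoc.comp
    ((measurable_snd.comp measurable_fst).prodMk measurable_snd))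

/-- The joint law of `(x^{t+1}, z^t)`. -/
noncomputable def priorLaw (t : ℕ) : Measure (SrcPath S.n (t + 1) × RepPath S.n t) :=
  (S.jointLaw γ t ⊗ₘ S.srcKernel t).map (fun ω => (srcSnoc ω.1.1 ω.2, ω.1.2))

instance (t : ℕ) : IsProbabilityMeasure (S.priorLaw γ t) :=
  Measure.isProbabilityMeasure_map (S.measurable_srcStep t).aemeasurable

theorem jointLaw_succ (t : ℕ) : S.jointLaw γ (t + 1) =
    (S.priorLaw γ t ⊗ₘ γ.kernel t).map (fun ω => (ω.1.1, repSnoc ω.1.2 ω.2)) := by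
  rw [priorLaw, ← map_compProd_comap _ _ (S.measurable_srcStep t),
    Measure.map_map (S.measurable_repStep t) ((S.measurable_srcStep t).prodMap measurable_id)]
  rfl

theorem map_repInit_jointLaw_succ (t : ℕ) :
    (S.jointLaw γ (t + 1)).map (fun ω => (ω.1, repInit ω.2)) = S.priorLaw γ t := by
  rw [jointLaw_succ, Measure.map_map (by fun_prop) (S.measurable_repStep t)]
  conv_rhs => rw [← Measure.fst_compProd (S.priorLaw γ t) (γ.kernel t), Measure.fst]
  congr 1
  funext ω
  simp

theorem map_castSucc_priorLaw (t : ℕ) :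
    (S.priorLaw γ t).map (fun ω => ((fun s => ω.1 s.castSucc : SrcPath S.n t), ω.2))
      = S.jointLaw γ t := by
  rw [priorLaw, Measure.map_map (by fun_prop) (S.measurable_srcStep t)]
  conv_rhs => rw [← Measure.fst_compProd (S.jointLaw γ t) (S.srcKernel t), Measure.fst]
  congr 1
  funext ω
  simp [srcSnoc_castSucc]

/-- All later kernels are Markov, so marginalising them out changes nothing. Hence statements under
the horizon-`T` law reduce to time t. -/
theorem map_truncPath_jointLaw {t N : ℕ} (h : t ≤ N) :
    (S.jointLaw γ N).map (truncPath h) = S.jointLaw γ t := by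
  induction N, h using Nat.le_induction with
  | base => exact Measure.map_id
  | succ N h ih =>
    rw [← ih, ← map_castSucc_priorLaw S γ N, ← map_repInit_jointLaw_succ,
      Measure.map_map (by fun_prop) (by fun_prop),
      Measure.map_map (by fun_prop) (by fun_prop)]
    rfl

theorem map_coords_jointLaw (t : Fin T) :
    (S.jointLaw γ T).map (fun ω => ((srcUpTo t ω, repBefore t ω), repAt t ω))
      = S.priorLaw γ t ⊗ₘ γ.kernel t := by
  have h1 : Measurable (fun ω : SrcPath S.n (t + 1) × RepPath S.n (t + 1) =>
      ((ω.1, repInit ω.2), ω.2 (Fin.last t))) :=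
    (measurable_fst.prodMk (measurable_repInit.comp measurable_snd)).prodMk (by fun_prop)
  have h2 : (fun ω : SrcPath S.n T × RepPath S.n T => ((srcUpTo t ω, repBefore t ω), repAt t ω)) =
      (fun ω : SrcPath S.n (t + 1) × RepPath S.n (t + 1) =>
        ((ω.1, repInit ω.2), ω.2 (Fin.last t))) ∘ truncPath (Nat.succ_le_of_lt t.isLt) := rfl
  rw [h2, ← Measure.map_map h1 (measurable_truncPath _), map_truncPath_jointLaw, jointLaw_succ,
    Measure.map_map h1 (S.measurable_repStep t)]
  conv_rhs => rw [← Measure.map_id (μ := S.priorLaw γ t ⊗ₘ γ.kernel t)]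
  congr 1
  funext ω
  simp

@[fun_prop]
theorem measurable_srcUpTo {n : ℕ → ℕ} (t : Fin T) : Measurable (srcUpTo (n := n) t) := by
  unfold srcUpTo; fun_prop

@[fun_prop]
theorem measurable_srcAt {n : ℕ → ℕ} (t : Fin T) : Measurable (srcAt (n := n) t) := by
  unfold srcAt; fun_prop

@[fun_prop]
theorem measurable_repAt {n : ℕ → ℕ} (t : Fin T) : Measurable (repAt (n := n) t) := by
  unfold repAt; fun_prop

@[fun_prop]
theorem measurable_repBefore {n : ℕ → ℕ} (t : Fin T) : Measurable (repBefore (n := n) t) := by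
  unfold repBefore; fun_prop

theorem map_prior_coords_jointLaw (t : Fin T) :
    (S.jointLaw γ T).map (fun ω => (srcUpTo t ω, repBefore t ω)) = S.priorLaw γ t := by
  conv_rhs => rw [← Measure.fst_compProd (S.priorLaw γ t) (γ.kernel t), ← map_coords_jointLaw,
    Measure.fst, Measure.map_map measurable_fst (((measurable_srcUpTo t).prodMk
      (measurable_repBefore t)).prodMk (measurable_repAt t))]
  rfl

/-- For a linear-Gaussian policy the two objectives agree. -/
theorem directedInfo_eq_stepwiseInfo (hγ : γ.IsLinearGaussian) :
    S.directedInfo γ = S.stepwiseInfo γ := by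
  obtain ⟨E, F, G, -, hk⟩ := hγ
  refine Finset.sum_congr rfl fun t _ => ?_
  -- The mean of z_{t+1} as a function of (z^t, x_{t+1}) alone: this is the kernel through which
  -- x^{t+1} acts only via its last entry.
  let f : RepPath S.n t × Vec (S.n (t + 1)) → Vec (S.n (t + 1)) := fun p =>
    toEuclideanLin (E t) p.2 + ∑ s : Fin t, toEuclideanLin (F t s) (p.1 s)
  have hf : Measurable f := by
    refine Measurable.add ((toEuclideanLin (E t)).continuous_of_finiteDimensional.measurable.comp
      measurable_snd) (Finset.measurable_sum _ fun s _ => ?_)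
    exact (toEuclideanLin (F t s)).continuous_of_finiteDimensional.measurable.comp
      ((measurable_pi_apply s).comp measurable_fst)
  have hl : Measurable (fun x : SrcPath S.n (t + 1) => x (Fin.last (t + 1))) :=
    measurable_pi_apply _
  refine condMutualInfo_comp_left_of_kernel (measurable_srcUpTo t) (measurable_repAt t)
    (measurable_repBefore t) hl (gaussianKernel f hf (G t)) ?_
  have h1 : (fun ω : SrcPath S.n T × RepPath S.n T =>
      ((repBefore t ω, srcUpTo t ω), repAt t ω)) = (Prod.map Prod.swap id) ∘
      fun ω => ((srcUpTo t ω, repBefore t ω), repAt t ω) := rfl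
  have h2 : (fun ω : SrcPath S.n T × RepPath S.n T => (repBefore t ω, srcUpTo t ω)) =
      Prod.swap ∘ fun ω => (srcUpTo t ω, repBefore t ω) := rfl
  rw [h1, ← Measure.map_map (by fun_prop) (((measurable_srcUpTo t).prodMk
      (measurable_repBefore t)).prodMk (measurable_repAt t)), map_coords_jointLaw,
    h2, ← Measure.map_map (by fun_prop) ((measurable_srcUpTo t).prodMk
      (measurable_repBefore t)), map_prior_coords_jointLaw, ← map_compProd_comap _ _ measurable_swap]
  congr 2
  ext p : 1
  exact hk t p.1 p.2

/-- The conditional law of `z_{t+1}` given `z^t`. -/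
noncomputable def repKernel (t : ℕ) : Kernel (RepPath S.n t) (Vec (S.n (t + 1))) :=
  condDistrib (fun ω => ω.2) (fun ω => ω.1.2) (S.priorLaw γ t ⊗ₘ γ.kernel t)

instance (t : ℕ) : IsMarkovKernel (S.repKernel γ t) := by
  unfold repKernel; infer_instance

theorem snd_priorLaw_compProd_repKernel (t : ℕ) :
    (S.priorLaw γ t ⊗ₘ γ.kernel t).map (fun ω => (ω.1.2, ω.2)) =
      (S.priorLaw γ t).map Prod.snd ⊗ₘ S.repKernel γ t := by
  rw [repKernel, ← compProd_map_condDistrib measurable_snd.aemeasurable]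
  congr 1
  conv_rhs => rw [← Measure.fst_compProd (S.priorLaw γ t) (γ.kernel t), Measure.fst,
    Measure.map_map measurable_snd measurable_fst]
  rfl

/-- This identifies each summand of the directed information with the cost of replacing the policy
kernel by the blind kernel in the chain rule. -/
theorem condMutualInfo_eq_klDiv_repKernel (t : Fin T) :
    condMutualInfo (S.jointLaw γ T) (srcUpTo t) (repAt t) (repBefore t) =
      klDiv (S.priorLaw γ t ⊗ₘ γ.kernel t)
        (S.priorLaw γ t ⊗ₘ (S.repKernel γ t).comap Prod.snd measurable_snd) := by
  have hm : Measurable (fun ω : SrcPath S.n T × RepPath S.n T =>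
      ((srcUpTo t ω, repBefore t ω), repAt t ω)) := ((measurable_srcUpTo t).prodMk
      (measurable_repBefore t)).prodMk (measurable_repAt t)
  have hm' : Measurable (fun ω : SrcPath S.n T × RepPath S.n T =>
      (srcUpTo t ω, repBefore t ω)) := (measurable_srcUpTo t).prodMk (measurable_repBefore t)
  have hκ : (S.jointLaw γ T).map (fun ω => (repBefore t ω, repAt t ω)) =
      (S.jointLaw γ T).map (repBefore t) ⊗ₘ S.repKernel γ t := by
    have h := S.snd_priorLaw_compProd_repKernel γ t
    rw [← map_coords_jointLaw, ← map_prior_coords_jointLaw, Measure.map_map (by fun_prop) hm,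
      Measure.map_map (by fun_prop) hm'] at h
    exact h
  rw [condMutualInfo_eq_klDiv_of_right (measurable_srcUpTo t) (measurable_repAt t) hκ]
  let e : (SrcPath S.n (t + 1) × RepPath S.n t) × Vec (S.n (t + 1)) ≃ᵐ
      (RepPath S.n t × SrcPath S.n (t + 1)) × Vec (S.n (t + 1)) :=
    MeasurableEquiv.prodComm.prodCongr (MeasurableEquiv.refl _)
  rw [← map_coords_jointLaw, ← map_prior_coords_jointLaw, ← klDiv_map_measurableEquiv e,
    Measure.map_map e.measurable hm]
  congr 1
  have h2 : (fun ω : SrcPath S.n T × RepPath S.n T => (repBefore t ω, srcUpTo t ω)) =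
      Prod.swap ∘ fun ω => (srcUpTo t ω, repBefore t ω) := rfl
  rw [h2, ← Measure.map_map (by fun_prop) hm', ← map_compProd_comap _ _ measurable_swap]
  rfl

end GaussMarkovSource

/-! ### Moments, characteristic functions and null sets of Gaussian measures -/

section Gaussian

variable {d : ℕ} {S : Matrix (Fin d) (Fin d) ℝ}

theorem multivariateGaussian_eq_map_add (m : Vec d) (S : Matrix (Fin d) (Fin d) ℝ) :
    multivariateGaussian m S = (multivariateGaussian 0 S).map (fun w => m + w) := by
  rw [multivariateGaussian, multivariateGaussian, Measure.map_map (by fun_prop) (by fun_prop)]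
  congr 1
  funext x
  simp

theorem compProd_gaussianKernel {α : Type*} [MeasurableSpace α] (μ : Measure α)
    [IsFiniteMeasure μ] {f : α → Vec d} (hf : Measurable f) (S : Matrix (Fin d) (Fin d) ℝ) :
    μ ⊗ₘ gaussianKernel f hf S =
      (μ.prod (multivariateGaussian 0 S)).map (fun p => (p.1, f p.1 + p.2)) := by
  ext s hs
  have hm : Measurable (fun p : α × Vec d => (p.1, f p.1 + p.2)) := by fun_prop
  rw [Measure.compProd_apply hs, Measure.map_apply hm hs, Measure.prod_apply (hm hs)]
  refine lintegral_congr fun a => ?_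
  change multivariateGaussian (f a) S _ = _
  rw [multivariateGaussian_eq_map_add, Measure.map_apply (by fun_prop) (measurable_prodMk_left hs)]
  rfl

theorem memLp_multivariateGaussian (m : Vec d) (S : Matrix (Fin d) (Fin d) ℝ) :
    MemLp (fun w => w) 2 (multivariateGaussian m S) :=
  IsGaussian.memLp_two_id

theorem integral_inner_multivariateGaussian_zero (S : Matrix (Fin d) (Fin d) ℝ) (a : Vec d) :
    ∫ w, inner ℝ a w ∂(multivariateGaussian 0 S) = 0 := by
  rw [integral_inner ((memLp_multivariateGaussian 0 S).integrable (by norm_num)),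
    integral_id_multivariateGaussian, inner_zero_right]

theorem integral_inner_sq_multivariateGaussian_zero (hS : S.PosSemidef) (a : Vec d) :
    ∫ w, (inner ℝ a w) ^ 2 ∂(multivariateGaussian 0 S) = a.ofLp ⬝ᵥ S *ᵥ a.ofLp := by
  have h := covarianceBilin_multivariateGaussian (μ := (0 : Vec d)) hS a a
  rw [covarianceBilin_self (memLp_multivariateGaussian 0 S),
    variance_of_integral_eq_zero (by fun_prop)
      (integral_inner_multivariateGaussian_zero S a)] at h
  exact h

theorem charFunDual_multivariateGaussian_zero (hS : S.PosSemidef) (L : StrongDual ℝ (Vec d)) :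
    charFunDual (multivariateGaussian 0 S) L =
      Complex.exp (-((∫ w, (L w) ^ 2 ∂(multivariateGaussian 0 S) : ℝ) : ℂ) / 2) := by
  obtain ⟨a, rfl⟩ := (InnerProductSpace.toDual ℝ (Vec d)).surjective L
  rw [← charFun_toDual_symm_eq_charFunDual, LinearIsometryEquiv.symm_apply_apply,
    charFun_multivariateGaussian hS]
  simp only [InnerProductSpace.toDual_apply_apply]
  rw [integral_inner_sq_multivariateGaussian_zero hS]
  simp [neg_div]

/-- The marginal along `u` is a real Gaussian of variance uᵀSu > 0, hence has no atoms. -/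
theorem multivariateGaussian_inner_eq_const (hS : S.PosDef) (m : Vec d) {u : Vec d} (hu : u ≠ 0)
    (c : ℝ) : multivariateGaussian m S {x | inner ℝ u x = c} = 0 := by
  set L : StrongDual ℝ (Vec d) := InnerProductSpace.toDual ℝ (Vec d) u with hL
  have h1 : {x : Vec d | inner ℝ u x = c} = L ⁻¹' {c} := by
    ext x; simp [hL]
  have hv : Var[L; multivariateGaussian m S] = u.ofLp ⬝ᵥ S *ᵥ u.ofLp := by
    rw [← covarianceBilin_multivariateGaussian (μ := m) hS.posSemidef,
      covarianceBilin_self (memLp_multivariateGaussian m S)]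
    congr 1
  have hpos : 0 < u.ofLp ⬝ᵥ S *ᵥ u.ofLp := by
    have := hS.dotProduct_mulVec_pos (x := u.ofLp) (by simpa using hu)
    simpa using this
  have hne : (Var[L; multivariateGaussian m S]).toNNReal ≠ 0 := by
    rw [hv]; simpa using hpos
  have := nullSingletonClass_gaussianReal (μ := (multivariateGaussian m S)[L]) hne
  rw [h1, ← Measure.map_apply L.continuous.measurable (measurableSet_singleton c),
    IsGaussian.map_eq_gaussianReal]
  exact measure_singleton _

end Gaussian

/-! ### Gaussian copies of random vectors -/

section Copy

variable {Ω : Type*} [MeasurableSpace Ω] {μ : Measure Ω}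
  {E F : Type*} [NormedAddCommGroup E] [NormedSpace ℝ E] [MeasurableSpace E] [BorelSpace E]
  [NormedAddCommGroup F] [NormedSpace ℝ F] [MeasurableSpace F] [BorelSpace F]

/-- `ν` is the centred Gaussian measure with the second moments of the random vector `V`. -/
def IsGaussianCopy (ν : Measure E) (V : Ω → E) (μ : Measure Ω) : Prop :=
  ∀ L : StrongDual ℝ E, charFunDual ν L = Complex.exp (-((∫ ω, (L (V ω)) ^ 2 ∂μ : ℝ) : ℂ) / 2)

/-- `N(K v, S)` is the linear regression kernel of `X` given `V`: the residual `X - K V` is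
orthogonal to `V` and has second moments `S`. -/
def IsRegression {d : ℕ} (X : Ω → Vec d) (V : Ω → E) (K : E →L[ℝ] Vec d)
    (S : Matrix (Fin d) (Fin d) ℝ) (μ : Measure Ω) : Prop :=
  ∀ (L : StrongDual ℝ E) (a : Vec d), ∫ ω, (L (V ω) + inner ℝ a (X ω)) ^ 2 ∂μ =
    ∫ ω, (L (V ω) + inner ℝ a (K (V ω))) ^ 2 ∂μ + a.ofLp ⬝ᵥ S *ᵥ a.ofLp

theorem IsGaussianCopy.map {ν : Measure E} {V : Ω → E} (h : IsGaussianCopy ν V μ)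
    (A : E →L[ℝ] F) : IsGaussianCopy (ν.map A) (fun ω => A (V ω)) μ := by
  intro L
  rw [charFunDual_map, h]
  rfl

/-- The characteristic function on multiples of `L` is that of a centred real Gaussian. All moment
facts about copies are read off from such one-dimensional marginals. -/
theorem IsGaussianCopy.map_eq_gaussianReal {ν : Measure E} [IsFiniteMeasure ν] {V : Ω → E}
    (h : IsGaussianCopy ν V μ) (L : StrongDual ℝ E) :
    ν.map L = gaussianReal 0 (∫ ω, (L (V ω)) ^ 2 ∂μ).toNNReal := by
  refine Measure.ext_of_charFun (funext fun u => ?_)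
  rw [charFun_map_eq_charFunDual_smul, h, charFun_gaussianReal,
    Real.coe_toNNReal _ (integral_nonneg fun ω => sq_nonneg _)]
  simp only [_root_.smul_apply, smul_eq_mul, mul_pow, integral_const_mul]
  congr 1
  push_cast
  ring

theorem IsGaussianCopy.memLp {ν : Measure E} [IsFiniteMeasure ν] {V : Ω → E}
    (h : IsGaussianCopy ν V μ) (L : StrongDual ℝ E) : MemLp L 2 ν := by
  have h1 : MemLp (id ∘ L) 2 ν := by
    rw [← memLp_map_measure_iff (by fun_prop) (by fun_prop), h.map_eq_gaussianReal]
    exact memLp_id_gaussianReal' 2 (by simp)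
  exact h1

theorem IsGaussianCopy.integral_sq {ν : Measure E} [IsFiniteMeasure ν] {V : Ω → E}
    (h : IsGaussianCopy ν V μ) (L : StrongDual ℝ E) :
    ∫ v, (L v) ^ 2 ∂ν = ∫ ω, (L (V ω)) ^ 2 ∂μ := by
  have h1 : ∫ v, (L v) ^ 2 ∂ν = ∫ y, y ^ 2 ∂(ν.map L) := by
    rw [integral_map (by fun_prop) (by fun_prop)]
  rw [h1, h.map_eq_gaussianReal]
  have h2 := variance_fun_id_gaussianReal (μ := 0) (v := (∫ ω, (L (V ω)) ^ 2 ∂μ).toNNReal)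
  rw [variance_of_integral_eq_zero (by fun_prop) (by simp)] at h2
  rw [h2, Real.coe_toNNReal _ (integral_nonneg fun ω => sq_nonneg _)]

variable [SecondCountableTopology E]

/-- Adding independent Gaussian noise multiplies characteristic functions, so it adds the quadratic
forms in the exponents; `IsRegression` says that this sum is the quadratic form of `(V, X)`. The
vector `X` itself need not be Gaussian. -/
theorem IsGaussianCopy.compProd {d : ℕ} {ν : Measure E} [IsFiniteMeasure ν] {V : Ω → E}
    (h : IsGaussianCopy ν V μ) {X : Ω → Vec d} {K : E →L[ℝ] Vec d}
    {S : Matrix (Fin d) (Fin d) ℝ} (hS : S.PosSemidef) (hX : IsRegression X V K S μ) :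
    IsGaussianCopy (ν ⊗ₘ gaussianKernel K K.continuous.measurable S)
      (fun ω => (V ω, X ω)) μ := by
  intro L
  let A : E × Vec d →L[ℝ] E × Vec d :=
    (ContinuousLinearMap.fst ℝ E (Vec d)).prod
      (K.comp (ContinuousLinearMap.fst ℝ E (Vec d)) + ContinuousLinearMap.snd ℝ E (Vec d))
  set L₁ : StrongDual ℝ E := L.comp (.inl ℝ E (Vec d)) with hL₁
  obtain ⟨a, ha⟩ := (InnerProductSpace.toDual ℝ (Vec d)).surjective
    (L.comp (.inr ℝ E (Vec d)))
  have hL : ∀ v x, L (v, x) = L₁ v + inner ℝ a x := by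
    intro v x
    have h1 : inner ℝ a x = L.comp (.inr ℝ E (Vec d)) x := by
      rw [← ha]; simp
    rw [h1, hL₁]
    simp [← map_add]
  have e1 : (L.comp A).comp (.inl ℝ E (Vec d)) =
      L₁ + (InnerProductSpace.toDual ℝ (Vec d) a).comp K := by
    ext v
    simp [A, hL]
  have e2 : (L.comp A).comp (.inr ℝ E (Vec d)) = InnerProductSpace.toDual ℝ (Vec d) a := by
    ext v
    simp [A, hL]
  have hA : (fun p : E × Vec d => (p.1, K p.1 + p.2)) = A := rfl
  rw [compProd_gaussianKernel, hA, charFunDual_map, charFunDual_prod, e1, e2, h,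
    charFunDual_multivariateGaussian_zero hS, ← Complex.exp_add]
  simp only [hL, InnerProductSpace.toDual_apply_apply, _root_.add_apply,
    ContinuousLinearMap.comp_apply]
  rw [hX, integral_inner_sq_multivariateGaussian_zero hS]
  congr 1
  push_cast
  ring

/-- A Gaussian copy of `(V, X)` disintegrates along the linear regression kernel. -/
theorem IsGaussianCopy.eq_compProd [CompleteSpace E] {d : ℕ} {ν : Measure (E × Vec d)}
    [IsFiniteMeasure ν] {V : Ω → E} {X : Ω → Vec d} (h : IsGaussianCopy ν (fun ω => (V ω, X ω)) μ)
    {K : E →L[ℝ] Vec d}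
    {S : Matrix (Fin d) (Fin d) ℝ} (hS : S.PosSemidef) (hX : IsRegression X V K S μ) :
    ν = ν.fst ⊗ₘ gaussianKernel K K.continuous.measurable S := by
  refine Measure.ext_of_charFunDual (funext fun L => ?_)
  -- The right-hand side is also a Gaussian copy of `(V, X)`, and the characteristic function
  -- determines the measure.
  have h1 := (h.map (ContinuousLinearMap.fst ℝ E (Vec d))).compProd hS (X := X) hX
  rw [h L]
  exact (h1 L).symm

end Copy

/-! ### Linear regression in L² -/

section Regression

variable {Ω : Type*} [MeasurableSpace Ω] {μ : Measure Ω}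
  {E : Type*} [NormedAddCommGroup E] [NormedSpace ℝ E] {d d' : ℕ}

theorem ofLp_toEuclideanLin (A : Matrix (Fin d') (Fin d) ℝ) (x : Vec d) :
    (toEuclideanLin A x).ofLp = A *ᵥ x.ofLp := rfl

theorem inner_toEuclideanLin (A : Matrix (Fin d') (Fin d) ℝ) (a : Vec d') (x : Vec d) :
    inner ℝ a (toEuclideanLin A x) = inner ℝ (toEuclideanLin Aᵀ a) x := by
  simp only [EuclideanSpace.inner_eq_star_dotProduct, ofLp_toEuclideanLin, star_trivial]
  rw [dotProduct_comm, dotProduct_mulVec, dotProduct_comm, mulVec_transpose]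

theorem IsRegression.integral_inner_residual_sq {X : Ω → Vec d} {V : Ω → E}
    {K : E →L[ℝ] Vec d} {S : Matrix (Fin d) (Fin d) ℝ} (h : IsRegression X V K S μ) (a : Vec d) :
    ∫ ω, (inner ℝ a (X ω - K (V ω))) ^ 2 ∂μ = a.ofLp ⬝ᵥ S *ᵥ a.ofLp := by
  -- This linear form cancels the regression term and leaves the residual alone.
  have h1 := h (-((InnerProductSpace.toDual ℝ (Vec d) a).comp K)) a
  simp only [_root_.neg_apply, ContinuousLinearMap.comp_apply,
    InnerProductSpace.toDual_apply_apply, neg_add_cancel] at h1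
  simp only [ne_eq, OfNat.ofNat_ne_zero, not_false_eq_true, zero_pow, integral_zero,
    zero_add] at h1
  rw [← h1]
  refine integral_congr_ae (ae_of_all _ fun ω => ?_)
  simp only [inner_sub_right]
  ring

/-- Regression through an intermediate vector. -/
theorem IsRegression.trans {V : Ω → E} {X : Ω → Vec d} {Y : Ω → Vec d'}
    {K : E →L[ℝ] Vec d} {S : Matrix (Fin d) (Fin d) ℝ} {A : Matrix (Fin d') (Fin d) ℝ}
    {W : Matrix (Fin d') (Fin d') ℝ} (hX : IsRegression X V K S μ)
    (hY : IsRegression Y (fun ω => (V ω, X ω)) ((toEuclideanLin A).toContinuousLinearMap.comp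
      (ContinuousLinearMap.snd ℝ E (Vec d))) W μ) :
    IsRegression Y V ((toEuclideanLin A).toContinuousLinearMap.comp K) (A * S * Aᵀ + W) μ := by
  intro L a
  have h1 := hY (L.comp (ContinuousLinearMap.fst ℝ E (Vec d))) a
  have h2 := hX L (toEuclideanLin Aᵀ a)
  simp only [ContinuousLinearMap.comp_apply, ContinuousLinearMap.coe_fst',
    ContinuousLinearMap.coe_snd', LinearMap.coe_toContinuousLinearMap', inner_toEuclideanLin]
    at h1 h2 ⊢
  rw [h1, h2, add_assoc]
  congr 1
  rw [ofLp_toEuclideanLin, add_mulVec, dotProduct_add]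
  congr 1
  simp only [← mulVec_mulVec]
  rw [dotProduct_mulVec a.ofLp A, ← mulVec_transpose]

theorem isRegression_map {Ω' : Type*} [MeasurableSpace Ω'] {g : Ω' → Ω} {ν : Measure Ω'}
    (hg : Measurable g) [MeasurableSpace E] [BorelSpace E] [SecondCountableTopology E]
    {V : Ω → E} (hV : Measurable V) {X : Ω → Vec d} (hX : Measurable X)
    {K : E →L[ℝ] Vec d} {S : Matrix (Fin d) (Fin d) ℝ} :
    IsRegression X V K S (ν.map g) ↔
      IsRegression (fun ω => X (g ω)) (fun ω => V (g ω)) K S ν := by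
  refine forall_congr' fun L => forall_congr' fun a => ?_
  rw [integral_map hg.aemeasurable (by fun_prop), integral_map hg.aemeasurable (by fun_prop)]

/-- The added noise is centred and independent of everything in `Ω`, so the cross term in the square
integrates to zero. -/
theorem isRegression_compProd_gaussianKernel [IsProbabilityMeasure μ] [MeasurableSpace E]
    [BorelSpace E] [SecondCountableTopology E]
    {V : Ω → E} (hVm : Measurable V) (hV : MemLp V 2 μ) (K : E →L[ℝ] Vec d)
    {S : Matrix (Fin d) (Fin d) ℝ} (hS : S.PosSemidef) {f : Ω → Vec d} (hf : Measurable f)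
    (hfK : ∀ ω, f ω = K (V ω)) :
    IsRegression (fun p : Ω × Vec d => p.2) (fun p => V p.1) K S (μ ⊗ₘ gaussianKernel f hf S) := by
  rw [compProd_gaussianKernel, isRegression_map (by fun_prop) (by fun_prop) (by fun_prop)]
  intro L a
  simp only [hfK, inner_add_right, ← add_assoc]
  have h1 : MemLp (fun ω => L (V ω) + inner ℝ a (K (V ω))) 2 μ :=
    (L.comp_memLp' hV).add ((K.comp_memLp' hV).const_inner a)
  have h2 : MemLp (fun w : Vec d => inner ℝ a w) 2 (multivariateGaussian 0 S) :=
    (memLp_multivariateGaussian 0 S).const_inner a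
  have i1 := h1.integrable (q := 2) (by norm_num)
  have i2 := h2.integrable (q := 2) (by norm_num)
  have e : ∀ p : Ω × Vec d, (L (V p.1) + inner ℝ a (K (V p.1)) + inner ℝ a p.2) ^ 2 =
      (L (V p.1) + inner ℝ a (K (V p.1))) ^ 2 +
      (2 * ((L (V p.1) + inner ℝ a (K (V p.1))) * inner ℝ a p.2) + (inner ℝ a p.2) ^ 2) :=
    fun p => by ring
  simp only [e]
  have j1 : Integrable (fun p : Ω × Vec d => (L (V p.1) + inner ℝ a (K (V p.1))) ^ 2)
      (μ.prod (multivariateGaussian 0 S)) := h1.integrable_sq.comp_fst _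
  have j2 : Integrable (fun p : Ω × Vec d => (inner ℝ a p.2) ^ 2)
      (μ.prod (multivariateGaussian 0 S)) := h2.integrable_sq.comp_snd _
  have j3 : Integrable (fun p : Ω × Vec d =>
      2 * ((L (V p.1) + inner ℝ a (K (V p.1))) * inner ℝ a p.2))
      (μ.prod (multivariateGaussian 0 S)) := (i1.mul_prod i2).const_mul 2
  have j4 : Integrable (fun p : Ω × Vec d =>
      2 * ((L (V p.1) + inner ℝ a (K (V p.1))) * inner ℝ a p.2) + (inner ℝ a p.2) ^ 2)
      (μ.prod (multivariateGaussian 0 S)) := j3.add j2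
  rw [integral_add j1 j4, integral_add j3 j2, integral_const_mul,
    integral_prod_mul (fun ω => L (V ω) + inner ℝ a (K (V ω))) (fun w => inner ℝ a w),
    integral_inner_multivariateGaussian_zero,
    integral_fun_fst (fun ω => (L (V ω) + inner ℝ a (K (V ω))) ^ 2),
    integral_fun_snd (fun w => (inner ℝ a w : ℝ) ^ 2),
    integral_inner_sq_multivariateGaussian_zero hS]
  simp

/-- The linear forms of `V` span a finite-dimensional subspace of L², onto which `X` has an
orthogonal projection. There is no intercept: second moments are used uncentred throughout, to match
centred Gaussian copies. -/
theorem exists_linear_residual_orthogonal [FiniteDimensional ℝ E] {V : Ω → E} (hV : MemLp V 2 μ)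
    {X : Ω → ℝ} (hX : MemLp X 2 μ) :
    ∃ ℓ : StrongDual ℝ E, ∀ L : StrongDual ℝ E, ∫ ω, L (V ω) * (X ω - ℓ (V ω)) ∂μ = 0 := by
  let Φ : StrongDual ℝ E →ₗ[ℝ] Lp ℝ 2 μ :=
    { toFun := fun L => (L.comp_memLp' hV).toLp _
      map_add' := fun L L' => rfl
      map_smul' := fun c L => rfl }
  obtain ⟨ℓ, hℓ⟩ := (LinearMap.range Φ).starProjection_apply_mem (hX.toLp X)
  refine ⟨ℓ, fun L => ?_⟩
  have h := Submodule.inner_right_of_mem_orthogonal (K := LinearMap.range Φ) (u := Φ L)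
    (LinearMap.mem_range_self _ _)
    ((LinearMap.range Φ).sub_starProjection_mem_orthogonal (hX.toLp X))
  rw [← hℓ, L2.inner_def] at h
  rw [← h]
  refine integral_congr_ae ?_
  filter_upwards [(L.comp_memLp' hV).coeFn_toLp, (ℓ.comp_memLp' hV).coeFn_toLp, hX.coeFn_toLp,
    Lp.coeFn_sub (hX.toLp X) (Φ ℓ)] with ω h1 h2 h3 h4
  have h1' : (Φ L) ω = L (V ω) := h1
  have h2' : (Φ ℓ) ω = ℓ (V ω) := h2
  rw [h1', h4, Pi.sub_apply, h3, h2']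
  simp [mul_comm]

/-- Each coordinate is projected separately, and `S` is the Gram matrix of the residuals.
Orthogonality of the residuals to every linear form of `V` removes the cross terms. -/
theorem exists_isRegression [FiniteDimensional ℝ E] {V : Ω → E} (hV : MemLp V 2 μ)
    {X : Ω → Vec d} (hX : MemLp X 2 μ) :
    ∃ (K : E →L[ℝ] Vec d) (S : Matrix (Fin d) (Fin d) ℝ), S.PosSemidef ∧
      IsRegression X V K S μ := by
  have hXi : ∀ i, MemLp (fun ω => X ω i) 2 μ := fun i =>
    (EuclideanSpace.proj (𝕜 := ℝ) i).comp_memLp' hX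
  choose ℓ hℓ using fun i => exists_linear_residual_orthogonal hV (hXi i)
  let K : E →L[ℝ] Vec d := (EuclideanSpace.equiv (Fin d) ℝ).symm.toContinuousLinearMap.comp
    (ContinuousLinearMap.pi ℓ)
  have hK : ∀ v i, K v i = ℓ i v := fun v i => rfl
  let e : Fin d → Ω → ℝ := fun i ω => X ω i - ℓ i (V ω)
  have he : ∀ i, MemLp (e i) 2 μ := fun i => (hXi i).sub ((ℓ i).comp_memLp' hV)
  let S : Matrix (Fin d) (Fin d) ℝ := fun i j => ∫ ω, e i ω * e j ω ∂μ
  have hquad : ∀ a : Fin d → ℝ, ∫ ω, (∑ i, a i * e i ω) ^ 2 ∂μ = a ⬝ᵥ S *ᵥ a := by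
    intro a
    have hi : ∀ i j, Integrable (fun ω => a i * e i ω * (a j * e j ω)) μ := fun i j =>
      ((he i).const_mul (a i)).integrable_mul ((he j).const_mul (a j))
    simp only [dotProduct, mulVec, S, sq, Finset.sum_mul_sum]
    rw [integral_finsetSum _ fun i _ => integrable_finsetSum _ fun j _ => hi i j]
    refine Finset.sum_congr rfl fun i _ => ?_
    rw [integral_finsetSum _ fun j _ => hi i j, Finset.mul_sum]
    refine Finset.sum_congr rfl fun j _ => ?_
    rw [← integral_mul_const, ← integral_const_mul]
    congr 1
    funext ω
    ring
  refine ⟨K, S, ?_, fun L a => ?_⟩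
  · refine PosSemidef.of_dotProduct_mulVec_nonneg ?_ fun a => ?_
    · ext i j
      change ∫ ω, e j ω * e i ω ∂μ = ∫ ω, e i ω * e j ω ∂μ
      simp only [mul_comm]
    · rw [star_trivial, ← hquad]
      exact integral_nonneg fun ω => sq_nonneg _
  · let L' : StrongDual ℝ E := L + (InnerProductSpace.toDual ℝ (Vec d) a).comp K
    have hL' : ∀ v, L' v = L v + inner ℝ a (K v) := fun v => by simp [L']
    have e1 : ∀ ω, (L (V ω) + inner ℝ a (X ω)) ^ 2 = (L' (V ω)) ^ 2 +
        (∑ i, 2 * a i * (L' (V ω) * e i ω) + (∑ i, a i * e i ω) ^ 2) := by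
      intro ω
      have : inner ℝ a (X ω) = inner ℝ a (K (V ω)) + ∑ i, a i * e i ω := by
        rw [PiLp.inner_apply, PiLp.inner_apply, ← Finset.sum_add_distrib]
        refine Finset.sum_congr rfl fun i _ => ?_
        simp only [e, hK, RCLike.inner_apply, conj_trivial]
        ring
      rw [this, ← add_assoc, ← hL', add_sq, add_assoc, Finset.mul_sum]
      congr 2
      refine Finset.sum_congr rfl fun i _ => ?_
      ring
    have m1 : MemLp (fun ω => L' (V ω)) 2 μ := L'.comp_memLp' hV
    have m2 : MemLp (fun ω => ∑ i, a i * e i ω) 2 μ :=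
      memLp_finsetSum _ fun i _ => (he i).const_mul _
    have m3 : ∀ i, Integrable (fun ω => 2 * a i * (L' (V ω) * e i ω)) μ := fun i =>
      (m1.integrable_mul (he i)).const_mul _
    simp only [e1, ← hL']
    have m4 : Integrable (fun ω => ∑ i, 2 * a i * (L' (V ω) * e i ω) + (∑ i, a i * e i ω) ^ 2) μ :=
      (integrable_finsetSum _ fun i _ => m3 i).add m2.integrable_sq
    rw [integral_add m1.integrable_sq m4,
      integral_add (integrable_finsetSum _ fun i _ => m3 i) m2.integrable_sq,
      integral_finsetSum _ fun i _ => m3 i, hquad]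
    simp only [integral_const_mul, e, hℓ, mul_zero, Finset.sum_const_zero, zero_add]

end Regression

/-! ### Gaussian densities -/

section Density

open scoped MatrixOrder

variable {d : ℕ}

theorem stdGaussian_eq_withDensity : stdGaussian (Vec d) = volume.withDensity
    (fun x => ENNReal.ofReal (Real.exp (-(d / 2 * Real.log (2 * Real.pi)) - ‖x‖ ^ 2 / 2))) := by
  have hc : ∀ x : Vec d, Real.exp (-(d / 2 * Real.log (2 * Real.pi)) - ‖x‖ ^ 2 / 2) =
      Real.exp (-(d / 2 * Real.log (2 * Real.pi))) * Real.exp (-(1 / 2) * ‖x‖ ^ 2) := by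
    intro x
    rw [← Real.exp_add]
    ring_nf
  have hint : Integrable (fun x : Vec d =>
      Real.exp (-(d / 2 * Real.log (2 * Real.pi)) - ‖x‖ ^ 2 / 2)) := by
    simp only [hc]
    have h := GaussianFourier.integrable_cexp_neg_mul_sq_norm_add (V := Vec d) (b := 1 / 2)
      (by norm_num) 0 0
    refine Integrable.const_mul ?_ _
    refine h.norm.congr (ae_of_all _ fun x => ?_)
    simp [Complex.norm_exp, ← Complex.ofReal_pow]
  have : IsFiniteMeasure ((volume : Measure (Vec d)).withDensity
      (fun x => ENNReal.ofReal
        (Real.exp (-(d / 2 * Real.log (2 * Real.pi)) - ‖x‖ ^ 2 / 2)))) :=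
    isFiniteMeasure_withDensity_ofReal hint.2
  refine Measure.ext_of_charFun (funext fun t => ?_)
  rw [charFun_stdGaussian, charFun_apply, integral_withDensity_eq_integral_toReal_smul
    (by fun_prop) (by simp)]
  have h := GaussianFourier.integral_cexp_neg_mul_sq_norm_add (V := Vec d) (b := 1 / 2)
    (by norm_num) Complex.I t
  have e1 : ∀ x : Vec d, (ENNReal.ofReal
      (Real.exp (-(d / 2 * Real.log (2 * Real.pi)) - ‖x‖ ^ 2 / 2))).toReal •
      Complex.exp (inner ℝ x t * Complex.I) =
      Complex.exp (-(d / 2 * Real.log (2 * Real.pi))) *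
        Complex.exp (-(1 / 2) * ‖x‖ ^ 2 + Complex.I * inner ℝ t x) := by
    intro x
    rw [ENNReal.toReal_ofReal (Real.exp_pos _).le, Complex.real_smul, ← Complex.exp_add,
      Complex.ofReal_exp, ← Complex.exp_add, real_inner_comm]
    congr 1
    push_cast
    ring
  simp only [e1]
  rw [integral_const_mul, h]
  have e2 : ((Real.pi : ℂ) / (1 / 2)) ^ (Module.finrank ℝ (Vec d) / 2 : ℂ) =
      Complex.exp (d / 2 * Real.log (2 * Real.pi)) := by
    have h2 : (Real.pi : ℂ) / (1 / 2) = ((2 * Real.pi : ℝ) : ℂ) := by push_cast; ring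
    rw [h2, Complex.cpow_def_of_ne_zero (by exact_mod_cast (by positivity)),
      ← Complex.ofReal_log (by positivity), finrank_euclideanSpace_fin, mul_comm]
  rw [e2, ← mul_assoc, ← Complex.exp_add, neg_add_cancel, Complex.exp_zero, one_mul]
  congr 1
  rw [Complex.I_sq]
  ring

theorem sqrt_mul_sqrt_of_posSemidef {S : Matrix (Fin d) (Fin d) ℝ} (hS : S.PosSemidef) :
    CFC.sqrt S * CFC.sqrt S = S :=
  CFC.sqrt_mul_sqrt_self S hS.nonneg

theorem transpose_sqrt (S : Matrix (Fin d) (Fin d) ℝ) : (CFC.sqrt S)ᵀ = CFC.sqrt S := by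
  have h : (CFC.sqrt S).PosSemidef := (CFC.sqrt_nonneg S).posSemidef
  have h2 := h.isHermitian
  rwa [IsHermitian, conjTranspose_eq_transpose_of_trivial] at h2

theorem isUnit_det_sqrt {S : Matrix (Fin d) (Fin d) ℝ} (hS : S.PosDef) :
    IsUnit (CFC.sqrt S).det := by
  have h : (CFC.sqrt S).det * (CFC.sqrt S).det = S.det := by
    rw [← det_mul, sqrt_mul_sqrt_of_posSemidef hS.posSemidef]
  refine isUnit_iff_ne_zero.2 fun h0 => hS.det_pos.ne' ?_
  rw [← h, h0, zero_mul]

/-- The constant term of the logarithm of the density of `N(0, S)`. -/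
noncomputable def gaussianLogConst (S : Matrix (Fin d) (Fin d) ℝ) : ℝ :=
  -(d / 2 * Real.log (2 * Real.pi)) - Real.log |(CFC.sqrt S).det|

/-- The logarithm of the density of `N(0, S)`. -/
noncomputable def gaussianLogDensity (S : Matrix (Fin d) (Fin d) ℝ) (x : Vec d) : ℝ :=
  gaussianLogConst S - ‖toEuclideanLin (CFC.sqrt S)⁻¹ x‖ ^ 2 / 2

@[fun_prop]
theorem measurable_gaussianLogDensity (S : Matrix (Fin d) (Fin d) ℝ) :
    Measurable (gaussianLogDensity S) := by
  have := (toEuclideanLin (CFC.sqrt S)⁻¹).continuous_of_finiteDimensional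
  exact (continuous_const.sub ((this.norm.pow 2).div_const 2)).measurable

/-- Change of variables x ↦ m + Rx with R the square root of `S`, whose Jacobian supplies the
determinant in `gaussianLogConst`. -/
theorem multivariateGaussian_eq_withDensity {S : Matrix (Fin d) (Fin d) ℝ} (hS : S.PosDef)
    (m : Vec d) : multivariateGaussian m S = volume.withDensity
      (fun x => ENNReal.ofReal (Real.exp (gaussianLogDensity S (x - m)))) := by
  set R := CFC.sqrt S with hR
  have hu := isUnit_det_sqrt hS
  have hne : R.det ≠ 0 := hu.ne_zero
  have hdet : LinearMap.det (toEuclideanLin R) = R.det := by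
    rw [toEuclideanLin_eq_toLin_orthonormal, LinearMap.det_toLin]
  have hinv : ∀ x, toEuclideanLin R⁻¹ (toEuclideanLin R x) = x := by
    intro x
    apply (WithLp.ofLp_injective 2)
    rw [ofLp_toEuclideanLin, ofLp_toEuclideanLin, mulVec_mulVec, nonsing_inv_mul _ hu, one_mulVec]
  have hRm : Measurable (toEuclideanLin R) :=
    (toEuclideanLin R).continuous_of_finiteDimensional.measurable
  have hvol : (volume : Measure (Vec d)).map (fun x => m + toEuclideanLin R x) =
      ENNReal.ofReal |R.det⁻¹| • volume := by
    have : (fun x : Vec d => m + toEuclideanLin R x) = (fun y => m + y) ∘ toEuclideanLin R := rfl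
    rw [this, ← Measure.map_map (by fun_prop) hRm, Measure.map_linearMap_addHaar_eq_smul_addHaar _
      (by rw [hdet]; exact hne), Measure.map_smul, hdet, map_add_left_eq_self]
  ext s hs
  have hm : Measurable (fun x => m + toEuclideanLin R x) := measurable_const.add hRm
  have h1 : multivariateGaussian m S =
      (stdGaussian (Vec d)).map (fun x => m + toEuclideanLin R x) := rfl
  rw [h1, Measure.map_apply hm hs, stdGaussian_eq_withDensity, withDensity_apply _ (hm hs),
    withDensity_apply _ hs, ← lintegral_indicator (hm hs), ← lintegral_indicator hs]
  have h2 : volume = ENNReal.ofReal |R.det| •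
      (volume : Measure (Vec d)).map (fun x => m + toEuclideanLin R x) := by
    rw [hvol, smul_smul, ← ENNReal.ofReal_mul (abs_nonneg _), ← abs_mul, mul_inv_cancel₀ hne]
    simp
  conv_rhs => rw [h2]
  rw [lintegral_smul_measure, lintegral_map (Measurable.indicator (by fun_prop) hs) hm,
    smul_eq_mul, ← lintegral_const_mul' _ _ ENNReal.ofReal_ne_top]
  refine lintegral_congr fun x => ?_
  by_cases hx : x ∈ (fun x => m + toEuclideanLin R x) ⁻¹' s
  · rw [Set.indicator_of_mem hx, Set.indicator_of_mem (Set.mem_preimage.1 hx),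
      ← ENNReal.ofReal_mul (abs_nonneg _)]
    congr 1
    rw [add_sub_cancel_left, gaussianLogDensity, gaussianLogConst, ← hR, hinv, sub_right_comm,
      sub_eq_add_neg _ (Real.log _), Real.exp_add, Real.exp_neg,
      Real.exp_log (abs_pos.2 hne)]
    field_simp
  · rw [Set.indicator_of_notMem hx,
      Set.indicator_of_notMem (fun h => hx (Set.mem_preimage.2 h)), mul_zero]

/-- The log density is quadratic, so its mean depends on the second moments of `e` only and `e` need
not be Gaussian. Whitening by the inverse square root of `S` leaves `d` coordinates of second moment
1, whence the d/2. -/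
theorem integral_gaussianLogDensity {Ω : Type*} [MeasurableSpace Ω] {μ : Measure Ω}
    [IsProbabilityMeasure μ] {S : Matrix (Fin d) (Fin d) ℝ} (hS : S.PosDef) {e : Ω → Vec d}
    (he : MemLp e 2 μ) (h2 : ∀ a : Vec d, ∫ ω, (inner ℝ a (e ω)) ^ 2 ∂μ = a.ofLp ⬝ᵥ S *ᵥ a.ofLp) :
    Integrable (fun ω => gaussianLogDensity S (e ω)) μ ∧
      ∫ ω, gaussianLogDensity S (e ω) ∂μ = gaussianLogConst S - d / 2 := by
  have hu := isUnit_det_sqrt hS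
  set R := CFC.sqrt S with hR
  let b : Fin d → Vec d := fun i => toEuclideanLin (R⁻¹)ᵀ (EuclideanSpace.single i 1)
  have hn : ∀ x, ‖toEuclideanLin R⁻¹ x‖ ^ 2 = ∑ i, (inner ℝ (b i) x) ^ 2 := by
    intro x
    rw [EuclideanSpace.norm_sq_eq]
    refine Finset.sum_congr rfl fun i _ => ?_
    rw [← inner_toEuclideanLin, EuclideanSpace.inner_single_left]
    simp
  have hb : ∀ i, (b i).ofLp ⬝ᵥ S *ᵥ (b i).ofLp = 1 := by
    intro i
    have hS' : S = R * R := (sqrt_mul_sqrt_of_posSemidef hS.posSemidef).symm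
    have h3 : R *ᵥ (b i).ofLp = Pi.single i 1 := by
      rw [ofLp_toEuclideanLin, mulVec_mulVec, transpose_nonsing_inv, transpose_sqrt,
        mul_nonsing_inv _ hu, one_mulVec]
      simp
    rw [hS', ← mulVec_mulVec, h3, dotProduct_mulVec, ← mulVec_transpose, transpose_sqrt, ← hR, h3]
    simp
  have hi : ∀ i, Integrable (fun ω => (inner ℝ (b i) (e ω)) ^ 2) μ := fun i =>
    (he.const_inner (b i)).integrable_sq
  have hs : Integrable (fun ω => ‖toEuclideanLin R⁻¹ (e ω)‖ ^ 2 / 2) μ := by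
    simp only [hn]
    exact (integrable_finsetSum _ fun i _ => hi i).div_const 2
  refine ⟨(integrable_const _).sub hs, ?_⟩
  simp only [gaussianLogDensity, ← hR]
  rw [integral_sub (integrable_const _) hs, integral_div]
  simp only [hn]
  rw [integral_finsetSum _ fun i _ => hi i]
  simp only [h2, hb]
  simp

end Density

/-! ### The seminorm and its kernel -/

section WeightedNorm

open scoped MatrixOrder

variable {d : ℕ} {Θ : Matrix (Fin d) (Fin d) ℝ}

theorem exists_weightedNorm_eq (hΘ : Θ.PosSemidef) :
    ∃ C : Vec d →L[ℝ] Vec d, ∀ v, weightedNorm Θ v = ‖C v‖ := by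
  obtain ⟨B, hB⟩ := CStarAlgebra.nonneg_iff_eq_star_mul_self.mp hΘ.nonneg
  refine ⟨(toEuclideanLin B).toContinuousLinearMap, fun v => ?_⟩
  rw [weightedNorm, EuclideanSpace.norm_eq, hB, star_eq_conjTranspose,
    conjTranspose_eq_transpose_of_trivial,
    ← mulVec_mulVec, dotProduct_mulVec, vecMul_transpose]
  congr 1
  refine Finset.sum_congr rfl fun i _ => ?_
  simp [sq]

/-- A linear projection along the kernel of the seminorm `‖·‖_Θ`. -/
theorem exists_projection_weightedNorm (hΘ : Θ.PosSemidef) :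
    ∃ (L : Vec d →L[ℝ] Vec d) (c : ℝ), (∀ x z, weightedNorm Θ (x - L z) = weightedNorm Θ (x - z)) ∧
      ∀ z, ‖L z‖ ≤ c * weightedNorm Θ z := by
  obtain ⟨C, hC⟩ := exists_weightedNorm_eq hΘ
  -- A right inverse of `C` on its range, extended linearly to `B`, satisfies CBC = C. Then L = BC
  -- changes a vector only within the kernel of `C` and is bounded by ‖C z‖.
  obtain ⟨g, hg⟩ := (C : Vec d →ₗ[ℝ] Vec d).rangeRestrict.exists_rightInverse_of_surjective
    (LinearMap.range_rangeRestrict _)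
  obtain ⟨B, hB⟩ := g.exists_extend
  have hBC : ∀ z, C (B (C z)) = C z := by
    intro z
    have h1 : B (C z) = g ⟨C z, LinearMap.mem_range_self (C : Vec d →ₗ[ℝ] Vec d) z⟩ := by
      rw [← hB]; rfl
    have h2 := LinearMap.congr_fun hg ⟨C z, LinearMap.mem_range_self (C : Vec d →ₗ[ℝ] Vec d) z⟩
    rw [h1]
    exact congrArg Subtype.val h2
  refine ⟨B.toContinuousLinearMap.comp C, ‖B.toContinuousLinearMap‖, fun x z => ?_, fun z => ?_⟩
  · rw [hC, hC, map_sub, map_sub]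
    congr 2
    exact hBC z
  · rw [hC]
    exact B.toContinuousLinearMap.le_opNorm _

end WeightedNorm

section Composition

variable {d d' : ℕ}

theorem snd_compProd_gaussianKernel {C : Matrix (Fin d) (Fin d) ℝ} (hC : C.PosSemidef)
    (A : Matrix (Fin d') (Fin d) ℝ) {W : Matrix (Fin d') (Fin d') ℝ} (hW : W.PosSemidef)
    (hA : Measurable (toEuclideanLin A)) (m : Vec d) :
    (multivariateGaussian m C ⊗ₘ gaussianKernel (toEuclideanLin A) hA W).snd =
      multivariateGaussian (toEuclideanLin A m) (A * C * Aᵀ + W) := by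
  have hAC : (A * C * Aᵀ + W).PosSemidef := by
    have := hC.mul_mul_conjTranspose_same A
    rw [conjTranspose_eq_transpose_of_trivial] at this
    exact this.add hW
  rw [compProd_gaussianKernel, Measure.snd, Measure.map_map (by fun_prop) (by fun_prop)]
  refine Measure.ext_of_charFun (funext fun t => ?_)
  let Q : Vec d × Vec d' →L[ℝ] Vec d' := (toEuclideanLin A).toContinuousLinearMap.comp
    (ContinuousLinearMap.fst ℝ _ _) + ContinuousLinearMap.snd ℝ _ _
  have hQ : (Prod.snd ∘ fun p : Vec d × Vec d' => (p.1, toEuclideanLin A p.1 + p.2)) = Q := rfl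
  have e1 : ((InnerProductSpace.toDualMap ℝ (Vec d') t).comp Q).comp (.inl ℝ (Vec d) (Vec d')) =
      InnerProductSpace.toDualMap ℝ (Vec d) (toEuclideanLin Aᵀ t) := by
    ext v
    simp [Q, inner_toEuclideanLin]
  have e2 : ((InnerProductSpace.toDualMap ℝ (Vec d') t).comp Q).comp (.inr ℝ (Vec d) (Vec d')) =
      InnerProductSpace.toDualMap ℝ (Vec d') t := by
    ext v
    simp [Q]
  rw [hQ, charFun_eq_charFunDual_toDualMap, charFunDual_map, charFunDual_prod, e1, e2,
    ← charFun_eq_charFunDual_toDualMap, ← charFun_eq_charFunDual_toDualMap,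
    charFun_multivariateGaussian hC, charFun_multivariateGaussian hW,
    charFun_multivariateGaussian hAC, ← Complex.exp_add, ← inner_toEuclideanLin]
  have e3 : (toEuclideanLin Aᵀ t).ofLp ⬝ᵥ C *ᵥ (toEuclideanLin Aᵀ t).ofLp =
      t.ofLp ⬝ᵥ (A * C * Aᵀ) *ᵥ t.ofLp := by
    simp only [ofLp_toEuclideanLin, ← mulVec_mulVec]
    rw [dotProduct_mulVec t.ofLp A, ← mulVec_transpose]
  rw [e3, add_mulVec, dotProduct_add]
  congr 1
  rw [inner_zero_right]
  push_cast
  ring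

end Composition

/-! ### Comparison with blind policies -/

/-- The policy that reproduces without looking at the source. -/
noncomputable def blindPolicy {n : ℕ → ℕ} (κ : ∀ t, Kernel (RepPath n t) (Vec (n (t + 1))))
    [∀ t, IsMarkovKernel (κ t)] : ZeroDelayPolicy n where
  kernel t := (κ t).comap Prod.snd measurable_snd
  markov _ := inferInstance

namespace GaussMarkovSource

variable {T : ℕ} (S : GaussMarkovSource T) (γ : ZeroDelayPolicy S.n)

/-- Chain rule for the two kernels of a step: both laws share the source kernel, which contributes
nothing, and appending coordinates is a measurable map, to which data processing applies. -/
theorem klDiv_jointLaw_succ_le (γ' : ZeroDelayPolicy S.n) (t : ℕ) :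
    klDiv (S.jointLaw γ (t + 1)) (S.jointLaw γ' (t + 1)) ≤
      klDiv (S.jointLaw γ t) (S.jointLaw γ' t) +
        klDiv (S.priorLaw γ t ⊗ₘ γ.kernel t) (S.priorLaw γ t ⊗ₘ γ'.kernel t) := by
  rw [jointLaw_succ, jointLaw_succ]
  refine (klDiv_map_le _ _ (S.measurable_repStep t)).trans ?_
  rw [klDiv_compProd_eq_add]
  gcongr
  refine (klDiv_map_le _ _ (S.measurable_srcStep t)).trans ?_
  rw [klDiv_compProd_left]

/-- The joint law is close to the law with the same reproduction marginal in which the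
reproduction ignores the source. -/
theorem klDiv_jointLaw_blindPolicy_le :
    klDiv (S.jointLaw γ T) (S.jointLaw (blindPolicy (S.repKernel γ)) T) ≤ S.directedInfo γ := by
  have h : ∀ t, klDiv (S.jointLaw γ t) (S.jointLaw (blindPolicy (S.repKernel γ)) t) ≤
      ∑ s ∈ Finset.range t, klDiv (S.priorLaw γ s ⊗ₘ γ.kernel s)
        (S.priorLaw γ s ⊗ₘ (S.repKernel γ s).comap Prod.snd measurable_snd) := by
    intro t
    induction t with
    | zero =>
      -- At time 0 no reproduction has been made, so the law does not depend on the policy.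
      change klDiv (S.jointLaw γ 0) (S.jointLaw γ 0) ≤ _
      rw [klDiv_self]
      exact zero_le
    | succ t ih =>
      rw [Finset.sum_range_succ]
      exact (S.klDiv_jointLaw_succ_le γ _ t).trans (by gcongr; exact le_rfl)
  refine (h T).trans_eq ?_
  rw [directedInfo, Finset.sum_range]
  refine Finset.sum_congr rfl fun t _ => ?_
  rw [condMutualInfo_eq_klDiv_repKernel]

theorem jointLaw_absolutelyContinuous_blindPolicy (hγ : S.directedInfo γ < ⊤) {t : ℕ}
    (ht : t ≤ T) : S.jointLaw γ t ≪ S.jointLaw (blindPolicy (S.repKernel γ)) t := by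
  have h := (klDiv_ne_top_iff.1 ((S.klDiv_jointLaw_blindPolicy_le γ).trans_lt hγ).ne).1
  rw [← S.map_truncPath_jointLaw γ ht, ← S.map_truncPath_jointLaw _ ht]
  exact h.map (measurable_truncPath ht)

section BlindPolicy

variable (κ : ∀ t, Kernel (RepPath S.n t) (Vec (S.n (t + 1)))) [∀ t, IsMarkovKernel (κ t)]

theorem measurable_srcSnoc_repSnoc {n : ℕ → ℕ} (t : ℕ) :
    Measurable (fun q : (SrcPath n t × RepPath n t) × Vec (n (t + 1)) × Vec (n (t + 1)) =>
      (srcSnoc q.1.1 q.2.1, repSnoc q.1.2 q.2.2)) :=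
  (measurable_srcSnoc.comp ((measurable_fst.comp measurable_fst).prodMk
    (measurable_fst.comp measurable_snd))).prodMk
  (measurable_repSnoc.comp ((measurable_snd.comp measurable_fst).prodMk
    (measurable_snd.comp measurable_snd)))

/-- Given the past, x_{t+1} and z_{t+1} are independent under a blind policy. Hence x_{t+1} can be
integrated first with z_{t+1} fixed. -/
theorem jointLaw_blindPolicy_succ (t : ℕ) :
    S.jointLaw (blindPolicy κ) (t + 1) = (S.jointLaw (blindPolicy κ) t ⊗ₘ
      (S.srcKernel t ×ₖ (κ t).comap Prod.snd measurable_snd)).map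
      (fun q => (srcSnoc q.1.1 q.2.1, repSnoc q.1.2 q.2.2)) := by
  have h2 := compProd_prod_map_assoc_symm (S.jointLaw (blindPolicy κ) t) (S.srcKernel t)
    ((κ t).comap Prod.snd measurable_snd)
  have hg' : Measurable (fun ω : ((SrcPath S.n t × RepPath S.n t) × Vec (S.n (t + 1))) ×
      Vec (S.n (t + 1)) => (srcSnoc ω.1.1.1 ω.1.2, repSnoc ω.1.1.2 ω.2)) :=
    (measurable_srcSnoc_repSnoc t).comp MeasurableEquiv.prodAssoc.measurable
  change (((S.jointLaw (blindPolicy κ) t) ⊗ₘ (S.srcKernel t)) ⊗ₘ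
    ((κ t).comap Prod.snd measurable_snd).comap Prod.fst measurable_fst).map _ = _
  rw [← h2, Measure.map_map hg' MeasurableEquiv.prodAssoc.symm.measurable]
  rfl

theorem lintegral_jointLaw_blindPolicy_succ (t : ℕ)
    {φ : SrcPath S.n (t + 1) × RepPath S.n (t + 1) → ℝ≥0∞} (hφ : Measurable φ) :
    ∫⁻ ω, φ ω ∂(S.jointLaw (blindPolicy κ) (t + 1)) =
      ∫⁻ ω, ∫⁻ v, ∫⁻ x, φ (srcSnoc ω.1 x, repSnoc ω.2 v)
        ∂(multivariateGaussian (toEuclideanLin (S.A t) (ω.1 (Fin.last t))) (S.W t)) ∂(κ t ω.2)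
        ∂(S.jointLaw (blindPolicy κ) t) := by
  have hφg := hφ.comp (measurable_srcSnoc_repSnoc t)
  rw [jointLaw_blindPolicy_succ, lintegral_map hφ (measurable_srcSnoc_repSnoc t)]
  refine (Measure.lintegral_compProd hφg).trans ?_
  refine lintegral_congr fun ω => ?_
  rw [Kernel.prod_apply]
  exact lintegral_prod_symm' _ (hφg.comp measurable_prodMk_left)

/-- If the reproduction ignores the source, then no nontrivial linear form of `x_{t+1}` is almost
surely a function of `z^{t+1}`. -/
theorem jointLaw_blindPolicy_inner_eq {t : ℕ} (ht : t < T) {u : Vec (S.n (t + 1))} (hu : u ≠ 0)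
    {f : RepPath S.n (t + 1) → ℝ} (hf : Measurable f) :
    S.jointLaw (blindPolicy κ) (t + 1) {ω | inner ℝ u (ω.1 (Fin.last (t + 1))) = f ω.2} = 0 := by
  have hm : MeasurableSet {ω : SrcPath S.n (t + 1) × RepPath S.n (t + 1) |
      inner ℝ u (ω.1 (Fin.last (t + 1))) = f ω.2} :=
    measurableSet_eq_fun (by fun_prop) (by fun_prop)
  rw [← lintegral_indicator_one hm,
    S.lintegral_jointLaw_blindPolicy_succ κ t (measurable_one.indicator hm)]
  refine (lintegral_congr fun ω => ?_).trans lintegral_zero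
  refine (lintegral_congr fun v => ?_).trans lintegral_zero
  -- Even with z^{t+1} and the past fixed, x_{t+1} has the nondegenerate law N(A_t x_t, W_t).
  have h3 := multivariateGaussian_inner_eq_const (S.W_posDef t ht)
    (toEuclideanLin (S.A t) (ω.1 (Fin.last t))) hu (f (repSnoc ω.2 v))
  have hm' : MeasurableSet {x : Vec (S.n (t + 1)) | inner ℝ u x = f (repSnoc ω.2 v)} :=
    measurableSet_eq_fun (by fun_prop) (by fun_prop)
  rw [← h3, ← lintegral_indicator_one hm']
  refine lintegral_congr fun x => ?_
  simp [Set.indicator]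

end BlindPolicy

theorem memLp_src (t : ℕ) :
    MemLp (fun ω : SrcPath S.n t × RepPath S.n t => ω.1 (Fin.last t)) 2 (S.jointLaw γ t) := by
  induction t with
  | zero =>
    rw [jointLaw, memLp_map_measure_iff (by fun_prop)
      (measurable_srcInit.prodMk measurable_const).aemeasurable]
    exact memLp_multivariateGaussian _ _
  | succ t ih =>
    have hA : Measurable (fun p : (SrcPath S.n t × RepPath S.n t) × Vec (S.n (t + 1)) =>
        (p.1, toEuclideanLin (S.A t) (p.1.1 (Fin.last t)) + p.2)) :=
      measurable_fst.prodMk (((toEuclideanLin (S.A t)).continuous_of_finiteDimensional.measurable.comp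
        (by fun_prop)).add measurable_snd)
    have hc : ((fun ω : SrcPath S.n (t + 1) × RepPath S.n t => ω.1 (Fin.last (t + 1))) ∘
        fun ω : (SrcPath S.n t × RepPath S.n t) × Vec (S.n (t + 1)) => (srcSnoc ω.1.1 ω.2, ω.1.2))
        = Prod.snd := by
      funext ω
      simp
    have h1 : MemLp (fun ω : SrcPath S.n (t + 1) × RepPath S.n t => ω.1 (Fin.last (t + 1))) 2
        (S.priorLaw γ t) := by
      rw [priorLaw, memLp_map_measure_iff (by fun_prop) (S.measurable_srcStep t).aemeasurable,
        hc, srcKernel, compProd_gaussianKernel,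
        memLp_map_measure_iff measurable_snd.aestronglyMeasurable hA.aemeasurable]
      have : MemLp (fun p : (SrcPath S.n t × RepPath S.n t) × Vec (S.n (t + 1)) =>
            (toEuclideanLin (S.A t)).toContinuousLinearMap (p.1.1 (Fin.last t)) + p.2) 2
            ((S.jointLaw γ t).prod (multivariateGaussian 0 (S.W t))) :=
          (((toEuclideanLin (S.A t)).toContinuousLinearMap.comp_memLp' ih).comp_fst _).add
            ((memLp_multivariateGaussian 0 (S.W t)).comp_snd _)
      exact this
    rw [← map_repInit_jointLaw_succ, memLp_map_measure_iff (by fun_prop) (by fun_prop)] at h1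
    exact h1

end GaussMarkovSource

/-! ### Regression data of a policy and the Gaussian lower bound -/

/-- Coordinatewise application of linear maps to a reproduction path. -/
noncomputable def repMap {n : ℕ → ℕ} (L : ∀ t, Vec (n (t + 1)) →L[ℝ] Vec (n (t + 1))) (t : ℕ) :
    RepPath n t →L[ℝ] RepPath n t :=
  ContinuousLinearMap.pi fun s => (L s).comp (ContinuousLinearMap.proj s)

theorem repMap_repInit {n : ℕ → ℕ} (L : ∀ t, Vec (n (t + 1)) →L[ℝ] Vec (n (t + 1))) (t : ℕ)
    (z : RepPath n (t + 1)) : repMap L t (repInit z) = repInit (repMap L (t + 1) z) := rfl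

theorem MeasureTheory.MemLp.prodMk_of_memLp {Ω E F : Type*} [MeasurableSpace Ω] {μ : Measure Ω}
    [NormedAddCommGroup E] [NormedAddCommGroup F] {p : ℝ≥0∞} {f : Ω → E} {g : Ω → F}
    (hf : MemLp f p μ) (hg : MemLp g p μ) : MemLp (fun ω => (f ω, g ω)) p μ := by
  refine (hf.norm.add hg.norm).mono (hf.1.prodMk hg.1) (ae_of_all _ fun ω => ?_)
  have h1 := norm_nonneg (f ω)
  have h2 := norm_nonneg (g ω)
  rw [Prod.norm_mk, Pi.add_apply, Real.norm_of_nonneg (add_nonneg h1 h2)]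
  exact max_le (by linarith) (by linarith)

namespace GaussMarkovSource

variable {T : ℕ} (S : GaussMarkovSource T) (γ : ZeroDelayPolicy S.n)

/-- Linear regressions for the joint law of a policy, with the reproductions `z_t` replaced by
square integrable linear images `L z_t`: of `x_t` on `z^t`, and of `z_{t+1}` on
`(z^t, x_{t+1})`. -/
structure RegressionData where
  L : ∀ t, Vec (S.n (t + 1)) →L[ℝ] Vec (S.n (t + 1))
  K : ∀ t, RepPath S.n t →L[ℝ] Vec (S.n t)
  C : ∀ t, Matrix (Fin (S.n t)) (Fin (S.n t)) ℝ
  F : ∀ t, RepPath S.n t × Vec (S.n (t + 1)) →L[ℝ] Vec (S.n (t + 1))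
  G : ∀ t, Matrix (Fin (S.n (t + 1))) (Fin (S.n (t + 1))) ℝ
  memLp_rep : ∀ t, MemLp (fun ω : SrcPath S.n t × RepPath S.n t => repMap L t ω.2) 2
    (S.jointLaw γ t)
  C_posSemidef : ∀ t, (C t).PosSemidef
  G_posSemidef : ∀ t, (G t).PosSemidef
  regression_src : ∀ t, IsRegression
    (fun ω : SrcPath S.n t × RepPath S.n t => ω.1 (Fin.last t)) (fun ω => repMap L t ω.2)
    (K t) (C t) (S.jointLaw γ t)
  regression_rep : ∀ t, IsRegression
    (fun ω : SrcPath S.n (t + 1) × RepPath S.n (t + 1) => L t (ω.2 (Fin.last t)))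
    (fun ω => (repMap L t (repInit ω.2), ω.1 (Fin.last (t + 1)))) (F t) (G t)
    (S.jointLaw γ (t + 1))

theorem map_prev_jointLaw (t : ℕ) : (S.jointLaw γ (t + 1)).map
    (fun ω => ((fun s => ω.1 s.castSucc : SrcPath S.n t), repInit ω.2)) = S.jointLaw γ t :=
  S.map_truncPath_jointLaw γ (Nat.le_succ t)

theorem memLp_repMap {L : ∀ t, Vec (S.n (t + 1)) →L[ℝ] Vec (S.n (t + 1))}
    (hL : ∀ t, MemLp (fun ω : SrcPath S.n (t + 1) × RepPath S.n (t + 1) =>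
      L t (ω.2 (Fin.last t))) 2 (S.jointLaw γ (t + 1))) (t : ℕ) :
    MemLp (fun ω : SrcPath S.n t × RepPath S.n t => repMap L t ω.2) 2 (S.jointLaw γ t) := by
  refine memLp_pi_iff.2 fun s => ?_
  have h := hL s
  rw [← S.map_truncPath_jointLaw γ (Nat.succ_le_of_lt s.isLt),
    memLp_map_measure_iff (by fun_prop) (by fun_prop)] at h
  exact h

theorem exists_regressionData {L : ∀ t, Vec (S.n (t + 1)) →L[ℝ] Vec (S.n (t + 1))}
    (hL : ∀ t, MemLp (fun ω : SrcPath S.n (t + 1) × RepPath S.n (t + 1) =>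
      L t (ω.2 (Fin.last t))) 2 (S.jointLaw γ (t + 1))) :
    ∃ R : S.RegressionData γ, R.L = L := by
  have hm := S.memLp_repMap γ hL
  have hm' : ∀ t, MemLp (fun ω : SrcPath S.n (t + 1) × RepPath S.n (t + 1) =>
      repMap L t (repInit ω.2)) 2 (S.jointLaw γ (t + 1)) := by
    intro t
    have h := hm t
    rw [← map_prev_jointLaw, memLp_map_measure_iff (by fun_prop) (by fun_prop)] at h
    exact h
  choose K C hC hK using fun t => exists_isRegression (hm t) (S.memLp_src γ t)
  choose F G hG hF using fun t =>
    exists_isRegression ((hm' t).prodMk_of_memLp (S.memLp_src γ (t + 1))) (hL t)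
  exact ⟨⟨L, K, C, F, G, hm, hC, hG, hK, hF⟩, rfl⟩

namespace RegressionData

variable {S γ} (R : S.RegressionData γ)

theorem memLp_rep_prev (t : ℕ) : MemLp (fun ω : SrcPath S.n (t + 1) × RepPath S.n (t + 1) =>
    repMap R.L t (repInit ω.2)) 2 (S.jointLaw γ (t + 1)) := by
  have h := R.memLp_rep t
  rw [← map_prev_jointLaw, memLp_map_measure_iff (by fun_prop) (by fun_prop)] at h
  exact h

theorem regression_src_prev (t : ℕ) : IsRegression
    (fun ω : SrcPath S.n (t + 1) × RepPath S.n (t + 1) => ω.1 (Fin.last t).castSucc)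
    (fun ω => repMap R.L t (repInit ω.2)) (R.K t) (R.C t) (S.jointLaw γ (t + 1)) := by
  have h := R.regression_src t
  rw [← map_prev_jointLaw, isRegression_map (by fun_prop) (by fun_prop) (by fun_prop)] at h
  exact h

/-- The covariance matrix of `x_{t+1}` given `z^t`. -/
noncomputable def predCov (t : ℕ) : Matrix (Fin (S.n (t + 1))) (Fin (S.n (t + 1))) ℝ :=
  S.A t * R.C t * (S.A t)ᵀ + S.W t

/-- The mean of `x_{t+1}` given `z^t`. -/
noncomputable def predMean (t : ℕ) : RepPath S.n t →L[ℝ] Vec (S.n (t + 1)) :=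
  (toEuclideanLin (S.A t)).toContinuousLinearMap.comp (R.K t)

theorem predCov_posDef {t : ℕ} (ht : t < T) : (R.predCov t).PosDef := by
  have h := (R.C_posSemidef t).mul_mul_conjTranspose_same (S.A t)
  rw [conjTranspose_eq_transpose_of_trivial] at h
  exact PosDef.posSemidef_add h (S.W_posDef t ht)

/-- The noise w_t is centred and independent of the whole past, reproductions included, whatever the
policy is. -/
theorem regression_srcStep {t : ℕ} (ht : t < T) : IsRegression
    (fun ω : SrcPath S.n (t + 1) × RepPath S.n (t + 1) => ω.1 (Fin.last (t + 1)))
    (fun ω => (repMap R.L t (repInit ω.2), ω.1 (Fin.last t).castSucc))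
    ((toEuclideanLin (S.A t)).toContinuousLinearMap.comp (ContinuousLinearMap.snd ℝ _ _))
    (S.W t) (S.jointLaw γ (t + 1)) := by
  have h := isRegression_compProd_gaussianKernel (μ := S.jointLaw γ t)
    (V := fun ω => (repMap R.L t ω.2, ω.1 (Fin.last t))) (by fun_prop)
    ((R.memLp_rep t).prodMk_of_memLp (S.memLp_src γ t))
    ((toEuclideanLin (S.A t)).toContinuousLinearMap.comp (ContinuousLinearMap.snd ℝ _ _))
    (S.W_posDef t ht).posSemidef
    (f := fun p => toEuclideanLin (S.A t) (p.1 (Fin.last t)))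
    ((toEuclideanLin (S.A t)).continuous_of_finiteDimensional.measurable.comp
      ((measurable_pi_apply (Fin.last t)).comp measurable_fst)) (fun ω => rfl)
  have h2 : IsRegression (fun ω : SrcPath S.n (t + 1) × RepPath S.n t => ω.1 (Fin.last (t + 1)))
      (fun ω => (repMap R.L t ω.2, ω.1 (Fin.last t).castSucc))
      ((toEuclideanLin (S.A t)).toContinuousLinearMap.comp (ContinuousLinearMap.snd ℝ _ _))
      (S.W t) (S.priorLaw γ t) := by
    rw [priorLaw, isRegression_map (S.measurable_srcStep t) (by fun_prop) (by fun_prop)]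
    simp only [srcSnoc_castSucc, srcSnoc_last]
    exact h
  rw [← map_repInit_jointLaw_succ, isRegression_map (by fun_prop) (by fun_prop) (by fun_prop)] at h2
  exact h2

theorem regression_pred {t : ℕ} (ht : t < T) : IsRegression
    (fun ω : SrcPath S.n (t + 1) × RepPath S.n (t + 1) => ω.1 (Fin.last (t + 1)))
    (fun ω => repMap R.L t (repInit ω.2)) (R.predMean t) (R.predCov t) (S.jointLaw γ (t + 1)) :=
  (R.regression_src_prev t).trans (R.regression_srcStep ht)

/-- If uᵀCu = 0, the residual of ⟨u, x_{t+1}⟩ vanishes almost surely under `γ`, so this linear form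
is a function of z^{t+1}. That event is null for the blind law, hence for `γ` by absolute
continuity: a contradiction. -/
theorem C_posDef (hγ : S.directedInfo γ < ⊤) {t : ℕ} (ht : t < T) : (R.C (t + 1)).PosDef := by
  refine PosDef.of_dotProduct_mulVec_pos (R.C_posSemidef _).isHermitian fun u hu => ?_
  have h0 := (R.C_posSemidef (t + 1)).dotProduct_mulVec_nonneg u
  refine lt_of_le_of_ne h0 fun heq => ?_
  rw [star_trivial] at heq
  have h1 := (R.regression_src (t + 1)).integral_inner_residual_sq (WithLp.toLp 2 u)
  have hmem := ((S.memLp_src γ (t + 1)).sub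
    ((R.K (t + 1)).comp_memLp' (R.memLp_rep (t + 1)))).const_inner (𝕜 := ℝ) (WithLp.toLp 2 u)
  rw [← heq] at h1
  replace h1 := (integral_eq_zero_iff_of_nonneg (fun ω => sq_nonneg _) hmem.integrable_sq).1 h1
  have h2 := S.jointLaw_blindPolicy_inner_eq (S.repKernel γ) ht (u := WithLp.toLp 2 u)
    (by simpa using hu)
    (f := fun z => inner ℝ (WithLp.toLp 2 u) (R.K (t + 1) (repMap R.L (t + 1) z))) (by fun_prop)
  have h3 := S.jointLaw_absolutelyContinuous_blindPolicy γ hγ (Nat.succ_le_of_lt ht) h2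
  have h4 : ∀ᵐ ω ∂(S.jointLaw γ (t + 1)), False := by
    filter_upwards [h1, measure_eq_zero_iff_ae_notMem.1 h3] with ω hω hω'
    have h5 := pow_eq_zero_iff (two_ne_zero) |>.1 hω
    exact hω' (sub_eq_zero.1 ((inner_sub_right _ _ _).symm.trans h5))
  rw [ae_iff] at h4
  simp at h4

/-- The logarithm of the ratio of the densities of `x_{t+1}` given `z^{t+1}` and given `z^t`. -/
noncomputable def logRatio (t : ℕ) (x : Vec (S.n (t + 1))) (z : RepPath S.n (t + 1)) : ℝ :=
  gaussianLogDensity (R.C (t + 1)) (x - R.K (t + 1) z) -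
    gaussianLogDensity (R.predCov t) (x - R.predMean t (repInit z))

@[fun_prop]
theorem measurable_logRatio (t : ℕ) :
    Measurable (fun p : Vec (S.n (t + 1)) × RepPath S.n (t + 1) => R.logRatio t p.1 p.2) := by
  unfold logRatio
  fun_prop

/-- The mean of `logRatio`. -/
noncomputable def infoRate (t : ℕ) : ℝ :=
  gaussianLogConst (R.C (t + 1)) - gaussianLogConst (R.predCov t)

/-- Only the second moments of the two residuals enter, and the two terms d/2 cancel. The vectors
are abstract because the lemma serves both `γ` and the Gaussian policy built from it. -/
theorem integral_logRatio {Ω : Type*} [MeasurableSpace Ω] {μ : Measure Ω} [IsProbabilityMeasure μ]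
    {t : ℕ} (hC : (R.C (t + 1)).PosDef) (hP : (R.predCov t).PosDef)
    {X : Ω → Vec (S.n (t + 1))} {Z : Ω → RepPath S.n (t + 1)}
    (h1 : MemLp (fun ω => X ω - R.K (t + 1) (Z ω)) 2 μ)
    (h1' : ∀ a : Vec (S.n (t + 1)), ∫ ω, (inner ℝ a (X ω - R.K (t + 1) (Z ω))) ^ 2 ∂μ =
      a.ofLp ⬝ᵥ R.C (t + 1) *ᵥ a.ofLp)
    (h2 : MemLp (fun ω => X ω - R.predMean t (repInit (Z ω))) 2 μ)
    (h2' : ∀ a : Vec (S.n (t + 1)), ∫ ω, (inner ℝ a (X ω - R.predMean t (repInit (Z ω)))) ^ 2 ∂μ =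
      a.ofLp ⬝ᵥ R.predCov t *ᵥ a.ofLp) :
    Integrable (fun ω => R.logRatio t (X ω) (Z ω)) μ ∧
      ∫ ω, R.logRatio t (X ω) (Z ω) ∂μ = R.infoRate t := by
  obtain ⟨i1, e1⟩ := integral_gaussianLogDensity hC h1 h1'
  obtain ⟨i2, e2⟩ := integral_gaussianLogDensity hP h2 h2'
  refine ⟨i1.sub i2, ?_⟩
  unfold logRatio
  rw [integral_sub i1 i2, e1, e2, infoRate]
  ring

/-- The logarithm of the likelihood ratio on paths. -/
noncomputable def logLik : ∀ t, SrcPath S.n t × RepPath S.n t → ℝ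
  | 0 => fun _ => 0
  | t + 1 => fun ω => logLik t ((fun s => ω.1 s.castSucc : SrcPath S.n t), repInit ω.2) +
      R.logRatio t (ω.1 (Fin.last (t + 1))) (repMap R.L (t + 1) ω.2)

@[fun_prop]
theorem measurable_logLik (t : ℕ) : Measurable (R.logLik t) := by
  induction t with
  | zero => exact measurable_const
  | succ t ih =>
    exact (ih.comp (by fun_prop)).add
      ((R.measurable_logRatio t).comp (f := fun ω : SrcPath S.n (t + 1) × RepPath S.n (t + 1) =>
        (ω.1 (Fin.last (t + 1)), repMap R.L (t + 1) ω.2)) (by fun_prop))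

theorem integral_logRatio_jointLaw (hγ : S.directedInfo γ < ⊤) {t : ℕ} (ht : t < T) :
    Integrable (fun ω : SrcPath S.n (t + 1) × RepPath S.n (t + 1) =>
        R.logRatio t (ω.1 (Fin.last (t + 1))) (repMap R.L (t + 1) ω.2)) (S.jointLaw γ (t + 1)) ∧
      ∫ ω, R.logRatio t (ω.1 (Fin.last (t + 1))) (repMap R.L (t + 1) ω.2)
        ∂(S.jointLaw γ (t + 1)) = R.infoRate t :=
  integral_logRatio R (R.C_posDef hγ ht) (R.predCov_posDef ht)
    ((S.memLp_src γ (t + 1)).sub ((R.K (t + 1)).comp_memLp' (R.memLp_rep (t + 1))))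
    (R.regression_src (t + 1)).integral_inner_residual_sq
    ((S.memLp_src γ (t + 1)).sub ((R.predMean t).comp_memLp' (R.memLp_rep_prev t)))
    (R.regression_pred ht).integral_inner_residual_sq

theorem integral_logLik (hγ : S.directedInfo γ < ⊤) {t : ℕ} (ht : t ≤ T) :
    Integrable (R.logLik t) (S.jointLaw γ t) ∧
      ∫ ω, R.logLik t ω ∂(S.jointLaw γ t) = ∑ s ∈ Finset.range t, R.infoRate s := by
  induction t with
  | zero => simp [logLik]
  | succ t ih =>
    obtain ⟨i1, e1⟩ := ih (Nat.le_of_succ_le ht)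
    obtain ⟨i2, e2⟩ := R.integral_logRatio_jointLaw hγ ht
    rw [← map_prev_jointLaw, integrable_map_measure (by fun_prop) (by fun_prop)] at i1
    rw [← map_prev_jointLaw, integral_map (by fun_prop) (by fun_prop)] at e1
    refine ⟨i1.add i2, ?_⟩
    rw [Finset.sum_range_succ, ← e1, ← e2]
    exact integral_add i1 i2

end RegressionData

end GaussMarkovSource

theorem lintegral_multivariateGaussian_toEuclideanLin {d d' : ℕ} {C : Matrix (Fin d) (Fin d) ℝ}
    (hC : C.PosSemidef) (A : Matrix (Fin d') (Fin d) ℝ) {W : Matrix (Fin d') (Fin d') ℝ}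
    (hW : W.PosSemidef) (m : Vec d) {f : Vec d' → ℝ≥0∞} (hf : Measurable f) :
    ∫⁻ y, ∫⁻ x, f x ∂(multivariateGaussian (toEuclideanLin A y) W) ∂(multivariateGaussian m C) =
      ∫⁻ x, f x ∂(multivariateGaussian (toEuclideanLin A m) (A * C * Aᵀ + W)) := by
  have hA : Measurable (toEuclideanLin A) :=
    (toEuclideanLin A).continuous_of_finiteDimensional.measurable
  rw [← snd_compProd_gaussianKernel hC A hW hA m, Measure.snd, lintegral_map hf measurable_snd]
  exact (Measure.lintegral_compProd (κ := gaussianKernel (toEuclideanLin A) hA W)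
    (hf.comp measurable_snd)).symm

theorem multivariateGaussian_eq_withDensity_exp_sub {d : ℕ} {C P : Matrix (Fin d) (Fin d) ℝ}
    (hC : C.PosDef) (hP : P.PosDef) (m m' : Vec d) :
    multivariateGaussian m C = (multivariateGaussian m' P).withDensity fun x =>
      ENNReal.ofReal (Real.exp (gaussianLogDensity C (x - m) - gaussianLogDensity P (x - m'))) := by
  rw [multivariateGaussian_eq_withDensity hC, multivariateGaussian_eq_withDensity hP,
    ← withDensity_mul _ (by fun_prop) (by fun_prop)]
  congr 1
  funext x
  rw [Pi.mul_apply, ← ENNReal.ofReal_mul (Real.exp_nonneg _), ← Real.exp_add]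
  congr 2
  ring

theorem lintegral_exp_gaussianLogDensity_sub_mul {d : ℕ} {C P : Matrix (Fin d) (Fin d) ℝ}
    (hC : C.PosDef) (hP : P.PosDef) (m m' : Vec d) {f : Vec d → ℝ≥0∞} (hf : Measurable f) :
    ∫⁻ x, ENNReal.ofReal (Real.exp (gaussianLogDensity C (x - m) - gaussianLogDensity P (x - m'))) *
      f x ∂(multivariateGaussian m' P) = ∫⁻ x, f x ∂(multivariateGaussian m C) := by
  rw [multivariateGaussian_eq_withDensity_exp_sub hC hP m m',
    lintegral_withDensity_eq_lintegral_mul _ (by fun_prop) hf]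
  rfl

namespace GaussMarkovSource

variable {T : ℕ} (S : GaussMarkovSource T) {γ : ZeroDelayPolicy S.n}

namespace RegressionData

variable {S} (R : S.RegressionData γ)

/-- The path z^0 is empty, so the residual of x_0 is x_0 itself. -/
theorem multivariateGaussian_C_zero :
    multivariateGaussian 0 (R.C 0) = multivariateGaussian 0 S.P₀ := by
  refine Measure.ext_of_charFun (funext fun a => ?_)
  rw [charFun_multivariateGaussian (R.C_posSemidef 0),
    charFun_multivariateGaussian S.P₀_posDef.posSemidef,
    ← integral_inner_sq_multivariateGaussian_zero S.P₀_posDef.posSemidef,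
    ← (R.regression_src 0).integral_inner_residual_sq, jointLaw,
    integral_map (measurable_srcInit.prodMk measurable_const).aemeasurable (by fun_prop)]
  have h0 : ∀ z : RepPath S.n 0, R.K 0 (repMap R.L 0 z) = 0 := fun z => by
    rw [Subsingleton.elim (repMap R.L 0 z) 0, map_zero]
  simp only [h0, sub_zero]
  rfl

theorem logLik_snoc (t : ℕ) (x : SrcPath S.n t) (z : RepPath S.n t) (a v : Vec (S.n (t + 1))) :
    R.logLik (t + 1) (srcSnoc x a, repSnoc z v) =
      R.logLik t (x, z) + R.logRatio t a (repMap R.L (t + 1) (repSnoc z v)) := by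
  simp only [logLik, srcSnoc_last, srcSnoc_castSucc, repInit_repSnoc]

/-- The weight exp `logLik` makes N(K_t L z^t, C_t) the conditional law of x_t given z^t while
keeping the law of z^t. The case `g = 1` is the normalisation needed for Donsker-Varadhan, but the
induction must carry a test function of (x_t, z^t), since the next step looks at x_t. -/
theorem lintegral_exp_logLik (hγ : S.directedInfo γ < ⊤)
    (κ : ∀ t, Kernel (RepPath S.n t) (Vec (S.n (t + 1)))) [∀ t, IsMarkovKernel (κ t)] {t : ℕ}
    (ht : t ≤ T) {g : Vec (S.n t) × RepPath S.n t → ℝ≥0∞} (hg : Measurable g) :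
    ∫⁻ ω, ENNReal.ofReal (Real.exp (R.logLik t ω)) * g (ω.1 (Fin.last t), ω.2)
        ∂(S.jointLaw (blindPolicy κ) t) =
      ∫⁻ ω, ∫⁻ x, g (x, ω.2) ∂(multivariateGaussian (R.K t (repMap R.L t ω.2)) (R.C t))
        ∂(S.jointLaw (blindPolicy κ) t) := by
  induction t with
  | zero =>
    have h0 : ∀ z : RepPath S.n 0, R.K 0 (repMap R.L 0 z) = 0 := fun z => by
      rw [Subsingleton.elim (repMap R.L 0 z) 0, map_zero]
    have h1 : ∀ ω : SrcPath S.n 0 × RepPath S.n 0, ω.2 = fun s => s.elim0 :=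
      fun ω => Subsingleton.elim _ _
    simp only [h0, R.multivariateGaussian_C_zero, h1, lintegral_const, measure_univ, mul_one,
      logLik, Real.exp_zero, ENNReal.ofReal_one, one_mul]
    have hg' : Measurable fun ω : SrcPath S.n 0 × RepPath S.n 0 =>
        g (ω.1 (Fin.last 0), fun s => s.elim0) :=
      hg.comp (((measurable_pi_apply _).comp measurable_fst).prodMk measurable_const)
    rw [jointLaw, lintegral_map hg' (measurable_srcInit.prodMk measurable_const)]
    rfl
  | succ t ih =>
    have htT : t < T := ht
    let φ : RepPath S.n t × Vec (S.n (t + 1)) × Vec (S.n (t + 1)) → ℝ≥0∞ := fun p =>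
      ENNReal.ofReal (Real.exp (R.logRatio t p.2.2 (repMap R.L (t + 1) (repSnoc p.1 p.2.1)))) *
        g (p.2.2, repSnoc p.1 p.2.1)
    have hs : Measurable fun p : RepPath S.n t × Vec (S.n (t + 1)) × Vec (S.n (t + 1)) =>
        repSnoc p.1 p.2.1 :=
      measurable_repSnoc.comp (measurable_fst.prodMk (measurable_fst.comp measurable_snd))
    have hφ : Measurable φ := by
      have h1 := (R.measurable_logRatio t).comp ((measurable_snd.comp measurable_snd).prodMk
        ((repMap R.L (t + 1)).continuous.measurable.comp hs))
      exact (Real.measurable_exp.comp h1).ennreal_ofReal.mul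
        (hg.comp ((measurable_snd.comp measurable_snd).prodMk hs))
    have hφx : ∀ z v, Measurable fun x => φ (z, v, x) := fun z v => hφ.comp (by fun_prop)
    have hA : Measurable (toEuclideanLin (S.A t)) :=
      (toEuclideanLin (S.A t)).continuous_of_finiteDimensional.measurable
    -- The conditional mean of the next weighted test function given (x_t, z^t); the induction
    -- hypothesis is applied to it.
    let h : Vec (S.n t) × RepPath S.n t → ℝ≥0∞ := fun p => ∫⁻ v, ∫⁻ x, φ (p.2, v, x)
        ∂(multivariateGaussian (toEuclideanLin (S.A t) p.1) (S.W t)) ∂(κ t p.2)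
    have hh' : Measurable fun q : (Vec (S.n t) × RepPath S.n t) × Vec (S.n (t + 1)) =>
        ∫⁻ x, φ (q.1.2, q.2, x)
          ∂(multivariateGaussian (toEuclideanLin (S.A t) q.1.1) (S.W t)) := by
      have := Measurable.lintegral_kernel_prod_right'
        (κ := (gaussianKernel (toEuclideanLin (S.A t)) hA (S.W t)).comap
          (fun q : (Vec (S.n t) × RepPath S.n t) × Vec (S.n (t + 1)) => q.1.1) (by fun_prop))
        (f := fun p => φ (p.1.1.2, p.1.2, p.2)) (hφ.comp (by fun_prop))
      exact this
    have hv : ∀ y z, Measurable fun v => ∫⁻ x, φ (z, v, x)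
        ∂(multivariateGaussian (toEuclideanLin (S.A t) y) (S.W t)) := fun y z =>
      (hφ.comp measurable_prodMk_left).lintegral_prod_right'
    have hh : Measurable h :=
      Measurable.lintegral_kernel_prod_right' (κ := (κ t).comap Prod.snd measurable_snd) hh'
    have e1 : ∀ ω : SrcPath S.n t × RepPath S.n t,
        ∫⁻ v, ∫⁻ x, ENNReal.ofReal (Real.exp (R.logLik (t + 1) (srcSnoc ω.1 x, repSnoc ω.2 v))) *
          g (srcSnoc ω.1 x (Fin.last (t + 1)), repSnoc ω.2 v)
          ∂(multivariateGaussian (toEuclideanLin (S.A t) (ω.1 (Fin.last t))) (S.W t)) ∂(κ t ω.2) =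
        ENNReal.ofReal (Real.exp (R.logLik t ω)) * h (ω.1 (Fin.last t), ω.2) := by
      intro ω
      simp only [R.logLik_snoc, srcSnoc_last, Real.exp_add, ENNReal.ofReal_mul (Real.exp_nonneg _),
        mul_assoc]
      refine Eq.trans (lintegral_congr fun v => lintegral_const_mul _ (hφx ω.2 v)) ?_
      exact lintegral_const_mul _ (hv (ω.1 (Fin.last t)) ω.2)
    -- One filtering step: averaging over x_t ∼ N(K_t L z^t, C_t) produces the prediction law
    -- N(`predMean`, `predCov`) of x_{t+1}, which exp `logRatio` reweights to the updated Gaussian.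
    have e2 : ∀ z : RepPath S.n t,
        ∫⁻ y, h (y, z) ∂(multivariateGaussian (R.K t (repMap R.L t z)) (R.C t)) =
          ∫⁻ v, ∫⁻ x, g (x, repSnoc z v) ∂(multivariateGaussian
            (R.K (t + 1) (repMap R.L (t + 1) (repSnoc z v))) (R.C (t + 1))) ∂(κ t z) := by
      intro z
      refine (lintegral_lintegral_swap
        (μ := multivariateGaussian (R.K t (repMap R.L t z)) (R.C t)) (ν := κ t z)
        (f := fun y v => ∫⁻ x, φ (z, v, x)
        ∂(multivariateGaussian (toEuclideanLin (S.A t) y) (S.W t)))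
        (hh'.comp (by fun_prop : Measurable fun p : Vec (S.n t) × Vec (S.n (t + 1)) =>
          ((p.1, z), p.2))).aemeasurable).trans ?_
      refine lintegral_congr fun v => ?_
      rw [lintegral_multivariateGaussian_toEuclideanLin (R.C_posSemidef t) _
        (S.W_posDef t htT).posSemidef _ (hφx z v)]
      have h3 := lintegral_exp_gaussianLogDensity_sub_mul (R.C_posDef hγ htT)
        (R.predCov_posDef htT) (R.K (t + 1) (repMap R.L (t + 1) (repSnoc z v)))
        (R.predMean t (repInit (repMap R.L (t + 1) (repSnoc z v))))
        (f := fun x => g (x, repSnoc z v)) (hg.comp measurable_prodMk_right)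
      rw [← h3, ← repMap_repInit, repInit_repSnoc]
      simp only [φ, logRatio, ← repMap_repInit, repInit_repSnoc]
      rfl
    have hGm : Measurable fun ω : SrcPath S.n (t + 1) × RepPath S.n (t + 1) =>
        ∫⁻ x, g (x, ω.2) ∂(multivariateGaussian
            (R.K (t + 1) (repMap R.L (t + 1) ω.2)) (R.C (t + 1))) :=
      Measurable.lintegral_kernel_prod_right' (κ := gaussianKernel
        (fun ω : SrcPath S.n (t + 1) × RepPath S.n (t + 1) => R.K (t + 1) (repMap R.L (t + 1) ω.2))
        (by fun_prop) (R.C (t + 1))) (f := fun p => g (p.2, p.1.2)) (hg.comp (by fun_prop))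
    rw [S.lintegral_jointLaw_blindPolicy_succ κ t (by fun_prop),
      S.lintegral_jointLaw_blindPolicy_succ κ t hGm]
    simp only [e1]
    rw [ih htT.le hh]
    refine lintegral_congr fun ω => ?_
    rw [e2]
    simp

/-- The Gaussian lower bound on the directed information. -/
theorem ofReal_sum_infoRate_le (hγ : S.directedInfo γ < ⊤) :
    ENNReal.ofReal (∑ t ∈ Finset.range T, R.infoRate t) ≤ S.directedInfo γ := by
  obtain ⟨i, e⟩ := R.integral_logLik hγ le_rfl
  rw [← e]
  refine (ofReal_integral_le_klDiv (R.measurable_logLik T) i ?_).trans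
    (S.klDiv_jointLaw_blindPolicy_le γ)
  have h := R.lintegral_exp_logLik hγ (S.repKernel γ) le_rfl (g := fun _ => 1) measurable_const
  simpa using h.le

end RegressionData

end GaussMarkovSource

theorem compProd_eq_withDensity {α β : Type*} [MeasurableSpace α] [MeasurableSpace β]
    (μ : Measure α) [SFinite μ] (κ η : Kernel α β) [IsSFiniteKernel κ] [IsSFiniteKernel η]
    {f : α × β → ℝ≥0∞} (hf : Measurable f) (h : ∀ a, κ a = (η a).withDensity fun b => f (a, b)) :
    μ ⊗ₘ κ = (μ ⊗ₘ η).withDensity f := by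
  ext s hs
  rw [withDensity_apply _ hs, ← lintegral_indicator hs,
    Measure.lintegral_compProd (hf.indicator hs), Measure.compProd_apply hs]
  refine lintegral_congr fun a => ?_
  rw [h a, withDensity_apply _ (measurable_prodMk_left hs),
    ← lintegral_indicator (measurable_prodMk_left hs)]
  rfl

/-! ### Transfer of second moments to Gaussian copies -/

section Copy

variable {Ω : Type*} [MeasurableSpace Ω] {μ : Measure Ω}
  {E F : Type*} [NormedAddCommGroup E] [NormedSpace ℝ E] [MeasurableSpace E] [BorelSpace E]
  [NormedAddCommGroup F] [NormedSpace ℝ F] {d : ℕ}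

theorem isGaussianCopy_map [SecondCountableTopology E] {Ω' : Type*} [MeasurableSpace Ω']
    {g : Ω' → Ω} {μ' : Measure Ω'} (hg : Measurable g) {V : Ω → E} (hV : Measurable V)
    {ν : Measure E} :
    IsGaussianCopy ν V (μ'.map g) ↔ IsGaussianCopy ν (fun ω => V (g ω)) μ' := by
  refine forall_congr' fun L => ?_
  rw [integral_map hg.aemeasurable (by fun_prop)]

theorem memLp_euclidean_iff {f : Ω → Vec d} {p : ℝ≥0∞} :
    MemLp f p μ ↔ ∀ i, MemLp (fun ω => f ω i) p μ := by
  refine ⟨fun h i => (EuclideanSpace.proj (𝕜 := ℝ) i).comp_memLp' h, fun h => ?_⟩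
  exact (EuclideanSpace.equiv (Fin d) ℝ).symm.toContinuousLinearMap.comp_memLp'
    (memLp_pi_iff.2 h)

theorem IsGaussianCopy.memLp_clm {ν : Measure E} [IsFiniteMeasure ν] {V : Ω → E}
    (h : IsGaussianCopy ν V μ) (B : E →L[ℝ] Vec d) : MemLp (fun v => B v) 2 ν :=
  memLp_euclidean_iff.2 fun i => h.memLp ((EuclideanSpace.proj i).comp B)

theorem lintegral_norm_sq {f : Ω → Vec d} (hf : MemLp f 2 μ) :
    ∫⁻ ω, ENNReal.ofReal (‖f ω‖ ^ 2) ∂μ = ENNReal.ofReal (∑ i, ∫ ω, (f ω i) ^ 2 ∂μ) := by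
  have hi := memLp_euclidean_iff.1 hf
  rw [← integral_finsetSum _ fun i _ => (hi i).integrable_sq,
    ofReal_integral_eq_lintegral_ofReal (integrable_finsetSum _ fun i _ => (hi i).integrable_sq)
      (ae_of_all _ fun ω => Finset.sum_nonneg fun i _ => sq_nonneg _)]
  refine lintegral_congr fun ω => ?_
  rw [EuclideanSpace.real_norm_sq_eq]

theorem IsGaussianCopy.lintegral_norm_sq {ν : Measure E} [IsFiniteMeasure ν] {V : Ω → E}
    (h : IsGaussianCopy ν V μ) (B : E →L[ℝ] Vec d) (hV : MemLp (fun ω => B (V ω)) 2 μ) :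
    ∫⁻ v, ENNReal.ofReal (‖B v‖ ^ 2) ∂ν = ∫⁻ ω, ENNReal.ofReal (‖B (V ω)‖ ^ 2) ∂μ := by
  rw [_root_.lintegral_norm_sq (h.memLp_clm B), _root_.lintegral_norm_sq hV]
  congr 1
  exact Finset.sum_congr rfl fun i _ => h.integral_sq ((EuclideanSpace.proj i).comp B)

omit [MeasurableSpace E] [BorelSpace E] in
theorem IsRegression.comp_left {X : Ω → Vec d} {V : Ω → E} {K : E →L[ℝ] Vec d}
    {S : Matrix (Fin d) (Fin d) ℝ} (h : IsRegression X V K S μ) (B : E →L[ℝ] F)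
    {K' : F →L[ℝ] Vec d} (hK : ∀ v, K' (B v) = K v) :
    IsRegression X (fun ω => B (V ω)) K' S μ := by
  intro L a
  have h1 := h (L.comp B) a
  simp only [ContinuousLinearMap.comp_apply] at h1
  simp only [hK, h1]

end Copy

/-- Appending a reproduction, as a linear map. -/
noncomputable def repSnocL (n : ℕ → ℕ) (t : ℕ) :
    RepPath n t × Vec (n (t + 1)) →L[ℝ] RepPath n (t + 1) :=
  LinearMap.toContinuousLinearMap
    { toFun := fun p => repSnoc p.1 p.2
      map_add' := fun p q => by
        funext s
        refine Fin.lastCases ?_ (fun i => ?_) s <;> simp [repSnoc]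
      map_smul' := fun c p => by
        funext s
        refine Fin.lastCases ?_ (fun i => ?_) s <;> simp [repSnoc] }

/-- Splitting off the last reproduction, as a linear map. -/
noncomputable def repSplitL (n : ℕ → ℕ) (t : ℕ) :
    RepPath n (t + 1) →L[ℝ] RepPath n t × Vec (n (t + 1)) :=
  (ContinuousLinearMap.pi fun s : Fin t => ContinuousLinearMap.proj s.castSucc).prod
    (ContinuousLinearMap.proj (Fin.last t))

theorem repSnocL_repSplitL {n : ℕ → ℕ} {t : ℕ} (z : RepPath n (t + 1)) :
    repSnocL n t (repSplitL n t z) = z :=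
  repSnoc_repInit z

/-! ### The linear-Gaussian policy and its information -/

namespace GaussMarkovSource

variable {T : ℕ} {S : GaussMarkovSource T} {γ : ZeroDelayPolicy S.n}

namespace RegressionData

variable (R : S.RegressionData γ)

/-- The linear-Gaussian policy `z_{t+1} ∼ N(F (z^t, x_{t+1}), G)`. -/
noncomputable def policy : ZeroDelayPolicy S.n where
  kernel t := gaussianKernel (fun p => R.F t (p.2, p.1 (Fin.last (t + 1)))) (by fun_prop) (R.G t)
  markov _ := inferInstance

theorem isLinearGaussian_policy : R.policy.IsLinearGaussian := by
  let F : ∀ t, RepPath S.n t × Vec (S.n (t + 1)) →ₗ[ℝ] Vec (S.n (t + 1)) := fun t => R.F t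
  refine ⟨fun t => toEuclideanLin.symm (F t ∘ₗ LinearMap.inr ℝ (RepPath S.n t) (Vec (S.n (t + 1)))),
    fun t s => toEuclideanLin.symm (F t ∘ₗ
      LinearMap.inl ℝ (RepPath S.n t) (Vec (S.n (t + 1))) ∘ₗ
      LinearMap.single ℝ (fun s : Fin t => Vec (S.n (s + 1))) s), R.G, R.G_posSemidef,
    fun t x z => ?_⟩
  change multivariateGaussian (F t (z, x (Fin.last (t + 1)))) (R.G t) = _
  congr 1
  have h : ∑ s : Fin t, LinearMap.single ℝ (fun s : Fin t => Vec (S.n (s + 1))) s (z s) = z :=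
    Finset.univ_sum_single z
  simp only [LinearEquiv.apply_symm_apply, LinearMap.comp_apply]
  rw [← map_sum, ← map_sum, h, ← map_add]
  congr 1
  simp

/-- The law of `(z^t, x_t)` under the linear-Gaussian policy is the Gaussian copy of
`(L z^t, x_t)`. -/
def IsCopyAt (t : ℕ) : Prop :=
  IsGaussianCopy (E := RepPath S.n t × Vec (S.n t))
    ((S.jointLaw R.policy t).map (fun ω => (ω.2, ω.1 (Fin.last t))))
    (fun ω => (repMap R.L t ω.2, ω.1 (Fin.last t))) (S.jointLaw γ t)

theorem isCopyAt_zero : R.IsCopyAt 0 := by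
  have h1 : IsGaussianCopy (multivariateGaussian 0 S.P₀) (fun v => v)
      (multivariateGaussian 0 S.P₀) :=
    fun L => charFunDual_multivariateGaussian_zero S.P₀_posDef.posSemidef L
  have h2 := h1.map (ContinuousLinearMap.inr ℝ (RepPath S.n 0) (Vec (S.n 0)))
  have hm : Measurable fun v : Vec (S.n 0) =>
      ((srcInit v, fun s => s.elim0) : SrcPath S.n 0 × RepPath S.n 0) :=
    measurable_srcInit.prodMk measurable_const
  refine (isGaussianCopy_map (μ' := multivariateGaussian 0 S.P₀) hm (by fun_prop)).2 ?_
  rw [jointLaw, Measure.map_map (by fun_prop) hm]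
  convert h2 using 1
  · congr 1
    funext v
    exact Prod.ext (Subsingleton.elim _ _) rfl
  · funext v
    exact Prod.ext (Subsingleton.elim _ _) rfl

/-- The source step is the regression kernel of x_{t+1} on (L z^t, x_t), so it extends the copy; x_t
is then dropped. -/
theorem IsCopyAt.prior {t : ℕ} (h : R.IsCopyAt t) (ht : t < T) :
    IsGaussianCopy (E := RepPath S.n t × Vec (S.n (t + 1)))
      ((S.priorLaw R.policy t).map (fun ω => (ω.2, ω.1 (Fin.last (t + 1)))))
      (fun ω => (repMap R.L t (repInit ω.2), ω.1 (Fin.last (t + 1)))) (S.jointLaw γ (t + 1)) := by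
  unfold IsCopyAt at h
  rw [← S.map_prev_jointLaw γ t, isGaussianCopy_map (by fun_prop) (by fun_prop)] at h
  have h1 := h.compProd (S.W_posDef t ht).posSemidef (R.regression_srcStep ht)
  have hg : Measurable fun ω : SrcPath S.n t × RepPath S.n t => (ω.2, ω.1 (Fin.last t)) := by
    fun_prop
  rw [← map_compProd_comap _ _ hg] at h1
  have h2 := h1.map (((ContinuousLinearMap.fst ℝ (RepPath S.n t) (Vec (S.n t))).comp
    (ContinuousLinearMap.fst ℝ _ (Vec (S.n (t + 1))))).prod (ContinuousLinearMap.snd ℝ _ _))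
  rw [Measure.map_map (by fun_prop) (by fun_prop)] at h2
  rw [priorLaw, Measure.map_map (by fun_prop) (S.measurable_srcStep t)]
  have e : ((fun ω : SrcPath S.n (t + 1) × RepPath S.n t => (ω.2, ω.1 (Fin.last (t + 1)))) ∘
      fun ω : (SrcPath S.n t × RepPath S.n t) × Vec (S.n (t + 1)) =>
        (srcSnoc ω.1.1 ω.2, ω.1.2)) = fun ω => (ω.1.2, ω.2) := by
    funext ω
    simp
  rw [e]
  exact h2

/-- The policy kernel is by construction the regression kernel of L z_{t+1} on (L z^t, x_{t+1}), so
it extends the copy once more. -/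
theorem IsCopyAt.succ {t : ℕ} (h : R.IsCopyAt t) (ht : t < T) : R.IsCopyAt (t + 1) := by
  have h1 := (h.prior R ht).compProd (R.G_posSemidef t) (R.regression_rep t)
  have hg : Measurable fun ω : SrcPath S.n (t + 1) × RepPath S.n t =>
      (ω.2, ω.1 (Fin.last (t + 1))) := by fun_prop
  rw [← map_compProd_comap _ _ hg] at h1
  have h2 := h1.map (((repSnocL S.n t).comp
    (((ContinuousLinearMap.fst ℝ (RepPath S.n t) (Vec (S.n (t + 1)))).comp
      (ContinuousLinearMap.fst ℝ _ (Vec (S.n (t + 1))))).prod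
        (ContinuousLinearMap.snd ℝ _ _))).prod
    ((ContinuousLinearMap.snd ℝ (RepPath S.n t) (Vec (S.n (t + 1)))).comp
      (ContinuousLinearMap.fst ℝ _ (Vec (S.n (t + 1))))))
  rw [Measure.map_map (by fun_prop) (by fun_prop)] at h2
  unfold IsCopyAt
  rw [jointLaw_succ, Measure.map_map (by fun_prop) (S.measurable_repStep t)]
  convert h2 using 1
  · rfl
  · funext ω
    exact Prod.ext (repSnoc_repInit _).symm rfl

theorem isCopyAt {t : ℕ} (ht : t ≤ T) : R.IsCopyAt t := by
  induction t with
  | zero => exact R.isCopyAt_zero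
  | succ t ih => exact (ih (Nat.le_of_succ_le ht)).succ R ht

theorem map_prior_policy {t : ℕ} (ht : t < T) :
    (S.priorLaw R.policy t).map (fun ω => (ω.2, ω.1 (Fin.last (t + 1)))) =
      (S.priorLaw R.policy t).map Prod.snd ⊗ₘ
        gaussianKernel (R.predMean t) (R.predMean t).continuous.measurable (R.predCov t) := by
  have h := ((R.isCopyAt ht.le).prior R ht).eq_compProd (R.predCov_posDef ht).posSemidef
    (R.regression_pred ht)
  rwa [Measure.fst, Measure.map_map measurable_fst (by fun_prop)] at h

/-- The law of `((z^t, z_{t+1}), x_{t+1})` under the linear-Gaussian policy. -/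
noncomputable def stepLaw (t : ℕ) :
    Measure ((RepPath S.n t × Vec (S.n (t + 1))) × Vec (S.n (t + 1))) :=
  (S.jointLaw R.policy (t + 1)).map
    (fun ω => ((repInit ω.2, ω.2 (Fin.last t)), ω.1 (Fin.last (t + 1))))

instance (t : ℕ) : IsProbabilityMeasure (R.stepLaw t) :=
  Measure.isProbabilityMeasure_map (by fun_prop)

theorem isGaussianCopy_stepLaw {t : ℕ} (ht : t < T) :
    IsGaussianCopy (R.stepLaw t) (fun ω =>
      (repSplitL S.n t (repMap R.L (t + 1) ω.2), ω.1 (Fin.last (t + 1))))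
      (S.jointLaw γ (t + 1)) := by
  have h : IsGaussianCopy _ _ _ := R.isCopyAt (Nat.succ_le_of_lt ht)
  have h2 := h.map (((repSplitL S.n t).comp
    (ContinuousLinearMap.fst ℝ (RepPath S.n (t + 1)) (Vec (S.n (t + 1))))).prod
      (ContinuousLinearMap.snd ℝ _ _))
  rw [Measure.map_map (by fun_prop) (by fun_prop)] at h2
  exact h2

theorem stepLaw_eq_compProd {t : ℕ} (ht : t < T) :
    R.stepLaw t = (R.stepLaw t).fst ⊗ₘ gaussianKernel ((R.K (t + 1)).comp (repSnocL S.n t))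
      ((R.K (t + 1)).comp (repSnocL S.n t)).continuous.measurable (R.C (t + 1)) := by
  refine (R.isGaussianCopy_stepLaw ht).eq_compProd (R.C_posSemidef _) ?_
  refine (R.regression_src (t + 1)).comp_left (repSplitL S.n t) fun z => ?_
  exact congrArg (R.K (t + 1)) (repSnocL_repSplitL z)

/-- Under the policy, z^{t+1} plays the role of L z^{t+1} under `γ`, so no `repMap` appears here;
the residuals have the same second moments and the mean is the same `infoRate`. -/
theorem integral_logRatio_stepLaw (hγ : S.directedInfo γ < ⊤) {t : ℕ} (ht : t < T) :
    Integrable (fun p => R.logRatio t p.2 (repSnoc p.1.1 p.1.2)) (R.stepLaw t) ∧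
      ∫ p, R.logRatio t p.2 (repSnoc p.1.1 p.1.2) ∂(R.stepLaw t) = R.infoRate t := by
  have h := R.isGaussianCopy_stepLaw ht
  let B₁ : (RepPath S.n t × Vec (S.n (t + 1))) × Vec (S.n (t + 1)) →L[ℝ] Vec (S.n (t + 1)) :=
    ContinuousLinearMap.snd ℝ _ _ - ((R.K (t + 1)).comp (repSnocL S.n t)).comp
      (ContinuousLinearMap.fst ℝ _ _)
  let B₂ : (RepPath S.n t × Vec (S.n (t + 1))) × Vec (S.n (t + 1)) →L[ℝ] Vec (S.n (t + 1)) :=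
    ContinuousLinearMap.snd ℝ _ _ - (R.predMean t).comp
      ((ContinuousLinearMap.fst ℝ _ _).comp (ContinuousLinearMap.fst ℝ _ _))
  refine R.integral_logRatio (R.C_posDef hγ ht) (R.predCov_posDef ht)
    (X := fun p : (RepPath S.n t × Vec (S.n (t + 1))) × Vec (S.n (t + 1)) => p.2)
    (Z := fun p => repSnoc p.1.1 p.1.2)
    (h.memLp_clm B₁) (fun a => ?_) ?_ (fun a => ?_)
  · rw [← (R.regression_src (t + 1)).integral_inner_residual_sq a]
    refine (h.integral_sq ((InnerProductSpace.toDual ℝ _ a).comp B₁)).trans ?_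
    refine integral_congr_ae (ae_of_all _ fun ω => congrArg (· ^ 2)
      ((InnerProductSpace.toDual_apply_apply ..).trans (congrArg (inner ℝ a) ?_)))
    simp only [B₁, ContinuousLinearMap.coe_coe, _root_.sub_apply, ContinuousLinearMap.comp_apply,
      ContinuousLinearMap.coe_snd', ContinuousLinearMap.coe_fst', repSnocL_repSplitL]
  · simp only [repInit_repSnoc]
    exact h.memLp_clm B₂
  · simp only [repInit_repSnoc]
    rw [← (R.regression_pred ht).integral_inner_residual_sq a]
    exact h.integral_sq ((InnerProductSpace.toDual ℝ _ a).comp B₂)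

theorem measurable_logRatio_repSnoc (t : ℕ) :
    Measurable fun p : (RepPath S.n t × Vec (S.n (t + 1))) × Vec (S.n (t + 1)) =>
      R.logRatio t p.2 (repSnoc p.1.1 p.1.2) :=
  (R.measurable_logRatio t).comp
    (f := fun p : (RepPath S.n t × Vec (S.n (t + 1))) × Vec (S.n (t + 1)) =>
      (p.2, repSnoc p.1.1 p.1.2))
    (measurable_snd.prodMk (measurable_repSnoc.comp measurable_fst))

/-- Under the policy the conditional law of x_{t+1} given z^{t+1} is exactly the Gaussian in the
numerator of `logRatio`. Given z^t it is the one in the denominator (`map_prior_policy`), so this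
density is a true likelihood ratio. -/
theorem stepLaw_eq_withDensity (hγ : S.directedInfo γ < ⊤) {t : ℕ} (ht : t < T) :
    R.stepLaw t = ((R.stepLaw t).fst ⊗ₘ (gaussianKernel (R.predMean t)
      (R.predMean t).continuous.measurable (R.predCov t)).comap Prod.fst measurable_fst).withDensity
        fun p => ENNReal.ofReal (Real.exp (R.logRatio t p.2 (repSnoc p.1.1 p.1.2))) := by
  have hm : Measurable fun p : (RepPath S.n t × Vec (S.n (t + 1))) × Vec (S.n (t + 1)) =>
      ENNReal.ofReal (Real.exp (R.logRatio t p.2 (repSnoc p.1.1 p.1.2))) :=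
    (Real.measurable_exp.comp (R.measurable_logRatio_repSnoc t)).ennreal_ofReal
  conv_lhs => rw [R.stepLaw_eq_compProd ht]
  refine compProd_eq_withDensity _ _ _ hm fun p => ?_
  have h := multivariateGaussian_eq_withDensity_exp_sub (R.C_posDef hγ ht) (R.predCov_posDef ht)
    (R.K (t + 1) (repSnoc p.1 p.2)) (R.predMean t p.1)
  simp only [logRatio, repInit_repSnoc]
  exact h

/-- It is a divergence under the policy. Nonnegativity of each rate lets `ENNReal.ofReal` pass
through the sum of rates. -/
theorem infoRate_nonneg (hγ : S.directedInfo γ < ⊤) {t : ℕ} (ht : t < T) : 0 ≤ R.infoRate t := by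
  obtain ⟨i, e⟩ := R.integral_logRatio_stepLaw hγ ht
  rw [← e]
  exact integral_nonneg_of_withDensity_exp (R.measurable_logRatio_repSnoc t) i
    (R.stepLaw_eq_withDensity hγ ht)

theorem condMutualInfo_policy (hγ : S.directedInfo γ < ⊤) (t : Fin T) :
    condMutualInfo (S.jointLaw R.policy T) (srcAt t) (repAt t) (repBefore t) =
      ENNReal.ofReal (R.infoRate t) := by
  have hZ := measurable_repBefore (n := S.n) t
  have hX := measurable_srcAt (n := S.n) t
  have hY := measurable_repAt (n := S.n) t
  have hκ : (S.jointLaw R.policy T).map (fun ω => (repBefore t ω, srcAt t ω)) =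
      (S.jointLaw R.policy T).map (repBefore t) ⊗ₘ gaussianKernel (R.predMean t)
        (R.predMean t).continuous.measurable (R.predCov t) := by
    have h := R.map_prior_policy t.isLt
    rw [← map_prior_coords_jointLaw, Measure.map_map (by fun_prop) (by fun_prop),
      Measure.map_map (by fun_prop) (by fun_prop)] at h
    exact h
  have h3 : (S.jointLaw R.policy T).map (fun ω => ((repBefore t ω, repAt t ω), srcAt t ω)) =
      R.stepLaw t := by
    rw [stepLaw, ← S.map_truncPath_jointLaw _ (Nat.succ_le_of_lt t.isLt),
      Measure.map_map (by fun_prop) (by fun_prop)]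
    rfl
  have h4 : (S.jointLaw R.policy T).map (fun ω => (repBefore t ω, repAt t ω)) =
      (R.stepLaw t).fst := by
    rw [← h3, Measure.fst, Measure.map_map (by fun_prop) (by fun_prop)]
    rfl
  -- By symmetry the information is that of z_{t+1} about x_{t+1}, for which only the Gaussian
  -- conditional laws of x_{t+1} are needed; z_{t+1} may be degenerate.
  rw [condMutualInfo_comm hX hY, condMutualInfo_eq_klDiv_of_right hY hX hκ, h3, h4]
  obtain ⟨i, e⟩ := R.integral_logRatio_stepLaw hγ t.isLt
  rw [klDiv_withDensity_exp (R.measurable_logRatio_repSnoc t) i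
    (R.stepLaw_eq_withDensity hγ t.isLt)]
  exact congrArg _ e

theorem stepwiseInfo_policy_le (hγ : S.directedInfo γ < ⊤) :
    S.stepwiseInfo R.policy ≤ S.directedInfo γ := by
  refine le_trans (le_of_eq ?_) (R.ofReal_sum_infoRate_le hγ)
  rw [stepwiseInfo, Finset.sum_range, ENNReal.ofReal_sum_of_nonneg
    fun t _ => R.infoRate_nonneg hγ t.isLt]
  exact Finset.sum_congr rfl fun t _ => R.condMutualInfo_policy hγ t

/-- The distortion is a second moment of (z_{t+1}, x_{t+1}), which the copy preserves up to
replacing z_{t+1} by L z_{t+1}; the seminorm does not see this replacement. -/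
theorem distortion_policy (t : Fin T) {Θ : Matrix (Fin (S.n (t + 1))) (Fin (S.n (t + 1))) ℝ}
    (hΘ : Θ.PosSemidef)
    (hL : ∀ x z, weightedNorm Θ (x - R.L t z) = weightedNorm Θ (x - z)) :
    S.distortion R.policy t Θ = S.distortion γ t Θ := by
  obtain ⟨C, hC⟩ := exists_weightedNorm_eq hΘ
  have h : IsGaussianCopy _ _ _ := R.isCopyAt (Nat.succ_le_of_lt t.isLt)
  let B : RepPath S.n (t + 1) × Vec (S.n (t + 1)) →L[ℝ] Vec (S.n (t + 1)) :=
    C.comp (ContinuousLinearMap.snd ℝ _ _ -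
      (ContinuousLinearMap.proj (Fin.last t)).comp (ContinuousLinearMap.fst ℝ _ _))
  have hB := h.lintegral_norm_sq B (B.comp_memLp'
    ((R.memLp_rep (t + 1)).prodMk_of_memLp (S.memLp_src γ (t + 1))))
  rw [← S.map_truncPath_jointLaw R.policy (Nat.succ_le_of_lt t.isLt),
    ← S.map_truncPath_jointLaw γ (Nat.succ_le_of_lt t.isLt),
    Measure.map_map (by fun_prop) (by fun_prop), lintegral_map (by fun_prop) (by fun_prop),
    lintegral_map (by fun_prop) (by fun_prop)] at hB
  unfold distortion
  refine Eq.trans (lintegral_congr fun ω => ?_) (hB.trans (lintegral_congr fun ω => ?_))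
  · rw [hC]
    rfl
  · change ENNReal.ofReal (‖C (srcAt t ω - R.L t (repAt t ω))‖ ^ 2) = _
    rw [← hC, hL]

end RegressionData

end GaussMarkovSource

/-! ### Choice of the projections and conclusion -/

namespace GaussMarkovSource

variable {T : ℕ} (S : GaussMarkovSource T) (γ : ZeroDelayPolicy S.n)

/-- If the distortion is finite, then the reproduction is square integrable modulo the kernel of
the seminorm. -/
theorem exists_projection_memLp (t : Fin T)
    {Θ : Matrix (Fin (S.n (t + 1))) (Fin (S.n (t + 1))) ℝ} (hΘ : Θ.PosSemidef)
    (hfin : S.distortion γ t Θ < ⊤) :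
    ∃ L : Vec (S.n (t + 1)) →L[ℝ] Vec (S.n (t + 1)),
      (∀ x z, weightedNorm Θ (x - L z) = weightedNorm Θ (x - z)) ∧
      MemLp (fun ω : SrcPath S.n (t + 1) × RepPath S.n (t + 1) => L (ω.2 (Fin.last t))) 2
        (S.jointLaw γ (t + 1)) := by
  obtain ⟨L, c, hL, hc⟩ := exists_projection_weightedNorm hΘ
  obtain ⟨C, hC⟩ := exists_weightedNorm_eq hΘ
  refine ⟨L, hL, ?_⟩
  let X : SrcPath S.n (t + 1) × RepPath S.n (t + 1) → Vec (S.n (t + 1)) :=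
    fun ω => ω.1 (Fin.last (t + 1))
  let Z : SrcPath S.n (t + 1) × RepPath S.n (t + 1) → Vec (S.n (t + 1)) :=
    fun ω => ω.2 (Fin.last t)
  have hX : MemLp X 2 (S.jointLaw γ (t + 1)) := S.memLp_src γ (t + 1)
  have hXm : Measurable X := (measurable_pi_apply (Fin.last _)).comp measurable_fst
  have hZm : Measurable Z := (measurable_pi_apply (Fin.last _)).comp measurable_snd
  have h1 : MemLp (fun ω => C (X ω - Z ω)) 2 (S.jointLaw γ (t + 1)) := by
    refine (memLp_two_iff_integrable_sq_norm (by fun_prop)).2 ⟨by fun_prop, ?_⟩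
    rw [hasFiniteIntegral_iff_ofReal (ae_of_all _ fun ω => sq_nonneg _)]
    rw [← S.map_truncPath_jointLaw γ (Nat.succ_le_of_lt t.isLt),
      lintegral_map (by fun_prop) (by fun_prop)]
    refine lt_of_eq_of_lt (lintegral_congr fun ω => ?_) hfin
    rw [← hC]
    rfl
  -- Since C z = C x - C(x - z) with both terms square integrable, the bound ‖L z‖ ≤ c ‖C z‖ makes L
  -- z square integrable.
  have h2 : MemLp (fun ω => c * ‖C (X ω) - C (X ω - Z ω)‖) 2 (S.jointLaw γ (t + 1)) :=
    ((C.comp_memLp' hX).sub h1).norm.const_mul c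
  refine h2.mono (by fun_prop) (ae_of_all _ fun ω => ?_)
  rw [map_sub, sub_sub_cancel, ← hC]
  exact (hc _).trans (le_abs_self _)

theorem exists_linearGaussian
    (Θ : ∀ t : Fin T, Matrix (Fin (S.n (t + 1))) (Fin (S.n (t + 1))) ℝ)
    (hΘ : ∀ t, (Θ t).PosSemidef) (hγ : S.directedInfo γ < ⊤) :
    ∃ γ₁ : ZeroDelayPolicy S.n, γ₁.IsLinearGaussian ∧
      (∀ t, S.distortion γ t (Θ t) < ⊤ → S.distortion γ₁ t (Θ t) = S.distortion γ t (Θ t)) ∧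
      S.stepwiseInfo γ₁ ≤ S.directedInfo γ := by
  have h : ∀ t : ℕ, ∃ L : Vec (S.n (t + 1)) →L[ℝ] Vec (S.n (t + 1)),
      (∀ ht : t < T, S.distortion γ ⟨t, ht⟩ (Θ ⟨t, ht⟩) < ⊤ →
        ∀ x z, weightedNorm (Θ ⟨t, ht⟩) (x - L z) = weightedNorm (Θ ⟨t, ht⟩) (x - z)) ∧
      MemLp (fun ω : SrcPath S.n (t + 1) × RepPath S.n (t + 1) => L (ω.2 (Fin.last t))) 2
        (S.jointLaw γ (t + 1)) := by
    intro t
    by_cases ht : ∃ ht : t < T, S.distortion γ ⟨t, ht⟩ (Θ ⟨t, ht⟩) < ⊤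
    · obtain ⟨ht, hfin⟩ := ht
      obtain ⟨L, h1, h2⟩ := S.exists_projection_memLp γ ⟨t, ht⟩ (hΘ _) hfin
      exact ⟨L, fun _ _ => h1, h2⟩
    -- Where the distortion is infinite, or beyond the horizon, no distortion has to be matched and
    -- the reproduction may be discarded.
    · exact ⟨0, fun ht' hfin => absurd ⟨ht', hfin⟩ ht, MemLp.zero⟩
  choose L hL hL2 using h
  obtain ⟨R, rfl⟩ := S.exists_regressionData γ hL2
  exact ⟨R.policy, R.isLinearGaussian_policy,
    fun t ht => R.distortion_policy t (hΘ t) (hL t t.isLt ht), R.stepwiseInfo_policy_le hγ⟩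

end GaussMarkovSource

theorem lemma1 {T : ℕ} (S : GaussMarkovSource T)
    (Θ : ∀ t : Fin T, Matrix (Fin (S.n (t + 1))) (Fin (S.n (t + 1))) ℝ)
    (hΘ : ∀ t, (Θ t).PosSemidef) (D : Fin T → ℝ≥0) :
    (∀ γ : ZeroDelayPolicy S.n, S.directedInfo γ < ⊤ →
      ∃ γ₁ : ZeroDelayPolicy S.n, γ₁.IsLinearGaussian ∧
        (∀ t, S.distortion γ t (Θ t) < ⊤ →
          S.distortion γ₁ t (Θ t) = S.distortion γ t (Θ t)) ∧
        (S.IsFeasible Θ D γ → S.IsFeasible Θ D γ₁) ∧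
        S.stepwiseInfo γ₁ ≤ S.directedInfo γ) ∧
    (∀ γ₁ : ZeroDelayPolicy S.n, γ₁.IsLinearGaussian →
      S.directedInfo γ₁ = S.stepwiseInfo γ₁) := by
  refine ⟨fun γ hγ => ?_, fun γ₁ h => S.directedInfo_eq_stepwiseInfo γ₁ h⟩
  obtain ⟨γ₁, h1, h2, h3⟩ := S.exists_linearGaussian γ Θ hΘ hγ
  refine ⟨γ₁, h1, h2, fun hf t => ?_, h3⟩
  -- The bounds D_t are finite, so feasibility makes every distortion finite and the equality of
  -- distortions applies.
  rw [h2 t ((hf t).trans_lt ENNReal.coe_lt_top)]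
  exact hf t
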